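/- Fix integers $K\ge r\ge 1$ (number of machines and computation load). For a graph $G=(\mathcal V,\mathcal E)$ with $|\mathcal V|=n$, $K\mid n$, an allocation $A\in\mathcal A(r)$ consists of sets $\mathcal M_k\subseteq\mathcal V$ with $|\mathcal M_k|=rn/K$ and $\bigcup_k\mathcal M_k=\mathcal V$ (vertices mapped by machine $k$), and a partition of $\mathcal V$ into sets $\mathcal R_k$ with $|\mathcal R_k|=n/K$ (vertices reduced by machine $k$), $k\in[K]$. To every ordered pair $(i,j)$ of adjacent vertices belongs an arbitrary intermediate value $v_{i,j}\in\{0,1\}^T$, $T\ge1$. A feasible shuffle scheme lets each machine $k$ multicast a message $X_k\in\{0,1\}^{c_k}$ that is a function of its local values $\{v_{i,j}: (i,j)\in\mathcal E, j\in\mathcal M_k\}$, such that each machine $k$ can, for all intermediate values, recover $\{v_{i,j}:(i,j)\in\mathcal E, i\in\mathcal R_k, j\notin\mathcal M_k\}$ from its local values and the messages of the other machines. Let $L_A(r,G)$ be the minimum of $\frac{1}{n^2T}\sum_k c_k$ over all feasible schemes for $G$ and $A$, and for a random graph $\mathcal G$ let $L^*(r)=\inf_{A\in\mathcal A(r)}\mathbb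 E_{\mathcal G}[L_A(r,\mathcal G)]$. Let $\mathcal G$ be the random bipartite graph $\mathrm{RB}(n_1,n_2,q)$, which has two disjoint clusters of sizes $n_1,n_2$, no edges inside a cluster, and each edge between the clusters independently with probability $q\in(0,1]$. Let $n=n_1+n_2\to\infty$ through multiples of $K$, with $n_1=\Theta(n)$, $n_2=\Theta(n)$, $|n_1-n_2|=o(n)$ and $q=\omega(1/n^2)$, where $n_1,n_2,q$ and $T\ge 1$ may vary along the sequence and $K,r$ are fixed. Then $$\frac{1}{8r}\Big(1-\frac{2r}{K}\Big)\le\limsup_{n\to\infty}\frac{L^*(r)}{q},$$ and, if $K$ is even and $2r\le K$, $$\limsup_{n\to\infty}\frac{L^*(r)}{q}\le\frac{1}{2r}\Big(1-\frac{2r}{K}\Big).$$ -/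

import Mathlib

open Filter Asymptotics MeasureTheory ProbabilityTheory

/-- Binary strings of length `T`. -/
abbrev Bits (T : ℕ) : Type := Fin T → Bool

/-- Subgraph and computation allocations over the vertex set `V` for `K` machines with computation
load `r`: every vertex is mapped by at least one machine, every machine maps exactly `r * |V| / K`
vertices, and the reducers are partitioned into `K` parts of exactly `|V| / K` vertices. -/
structure Allocation (V : Type*) [Fintype V] (K r : ℕ) where
  /-- `M k` is the set of vertices mapped by machine `k`. -/
  M : Fin K → Finset V
  /-- `R k` is the set of vertices reduced by machine `k`. -/
  R : Fin K → Finset V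
  map_cover : ∀ v, ∃ k, v ∈ M k
  map_card : ∀ k, K * (M k).card = r * Fintype.card V
  reduce_cover : ∀ v, ∃ k, v ∈ R k
  reduce_disjoint : ∀ k l, k ≠ l → Disjoint (R k) (R l)
  reduce_card : ∀ k, K * (R k).card = Fintype.card V

section Shuffle

variable {V : Type*} [Fintype V] {K r : ℕ}

/-- Index set of the intermediate values: the pair `(i, j)` stands for the value `v_{i,j}` that the
reducer of `i` needs from the file of its neighbor `j`. -/
abbrev Present (G : SimpleGraph V) : Type _ := {p : V × V // G.Adj p.1 p.2}

/-- Indices of the intermediate values computed by machine `k` in the Map phase. -/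
abbrev Known (G : SimpleGraph V) (A : Allocation V K r) (k : Fin K) : Type _ :=
  {p : Present G // p.1.2 ∈ A.M k}

/-- Indices of the intermediate values that machine `k` has to recover in the Shuffle phase. -/
abbrev Needed (G : SimpleGraph V) (A : Allocation V K r) (k : Fin K) : Type _ :=
  {p : Present G // p.1.1 ∈ A.R k ∧ p.1.2 ∉ A.M k}

/-- A feasible Shuffle coding scheme for the graph `G`, the allocation `A` and intermediate values
of `T` bits: machine `k` multicasts `c k` bits that are a function of its local values, and
recovers the values it needs from its local values and the messages of the other machines, whatever
the intermediate values are. -/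
structure ShuffleScheme (G : SimpleGraph V) (A : Allocation V K r) (T : ℕ) where
  /-- Length of the message of machine `k`. -/
  c : Fin K → ℕ
  encode : ∀ k, (Known G A k → Bits T) → Bits (c k)
  decode : ∀ k, (Known G A k → Bits T) → (∀ l : {l : Fin K // l ≠ k}, Bits (c l)) →
    (Needed G A k → Bits T)
  correct : ∀ (v : Present G → Bits T) (k : Fin K),
    decode k (fun p => v p.1) (fun l => encode l (fun p => v p.1)) = fun p => v p.1

/-- The minimum total number of bits multicast by a feasible Shuffle coding scheme. -/
noncomputable def minBits (G : SimpleGraph V) (A : Allocation V K r) (T : ℕ) : ℕ :=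
  sInf {b | ∃ S : ShuffleScheme G A T, ∑ k, S.c k = b}

/-- The minimum communication load of the allocation `A` on `G`, normalized by `|V|² T`. -/
noncomputable def commLoad (G : SimpleGraph V) (A : Allocation V K r) (T : ℕ) : ℝ :=
  (minBits G A T : ℝ) / ((Fintype.card V : ℝ) ^ 2 * T)

end Shuffle

/-- The bipartite graph with clusters `Fin n₁`, `Fin n₂` and set of cross edges `E`. -/
def bipartiteGraph {n₁ n₂ : ℕ} (E : Set (Fin n₁ × Fin n₂)) : SimpleGraph (Fin n₁ ⊕ Fin n₂) where
  Adj x y := ∃ e ∈ E, (x = Sum.inl e.1 ∧ y = Sum.inr e.2) ∨ (x = Sum.inr e.2 ∧ y = Sum.inl e.1)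
  symm := ⟨by
    rintro x y ⟨e, he, h | h⟩
    · exact ⟨e, he, Or.inr ⟨h.2, h.1⟩⟩
    · exact ⟨e, he, Or.inl ⟨h.2, h.1⟩⟩⟩
  loopless := ⟨by
    rintro x ⟨e, -, ⟨h, h'⟩ | ⟨h, h'⟩⟩
    · exact Sum.inl_ne_inr (h.symm.trans h')
    · exact Sum.inr_ne_inl (h.symm.trans h')⟩

/-- The optimal average communication load `L*(r)` of the random bipartite model
`RB(n₁, n₂, q)`: every cross edge is present independently with probability `q`, and the allocation
is chosen before the graph is drawn. -/
noncomputable def optimalLoad (n₁ n₂ K r T : ℕ) (q : unitInterval) : ℝ :=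
  ⨅ A : Allocation (Fin n₁ ⊕ Fin n₂) K r,
    ∫ E : Set (Fin n₁ × Fin n₂), commLoad (bipartiteGraph E) A T ∂(setBernoulli Set.univ q)

/-! Lower bound. For a set `S` of machines, the messages must carry every value that is reduced in
`S` and mapped nowhere in `S` (`card_cut_mul_le_minBits`). Average this over a random `S` that
contains each machine independently with probability `x`: a missing pair `(i, j)` is then counted
with weight `x * (1 - x) ^ m`, where `m` is the number of machines mapping `j`
(`weighted_cut_le_minBits`). These machines reduce only `m * n / K` vertices, so of the roughly `n /
2` vertices in the cluster opposite `j`, at least `n / 2 * (1 - 2 * m / K)` miss `j`. With `x = 1 /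
(2 * r)` the resulting function of `m` lies above an affine function, tangent at `m = r` to a
quadratic minorant (`tangent_le_max_mul_pow`). The mean of `m` over all vertices is exactly `r`, so
the linear term cancels and `1 / (8 * r) * (1 - 2 * r / K)` remains.

Upper bound. Write `K = 2 * h`. Split the machines into two halves and the vertices into two equal
halves that nearly agree with the clusters. A machine reduces vertices of its own half and maps
vertices of the other, so almost all edges are served inside one half of the machines. There each
batch of files is mapped by `r` of the `h` machines, and in every group of `r + 1` machines one
multicast bit serves up to `r` members (`minBits_le_coded`). A group costs `(r + 1) / r` times the
largest demand among its members. Second moments show that the expected maximum exceeds the bound on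
the mean by `O(n * √q)` only (`integral_sup_card_adj_le`), which is `o(n ^ 2 * q)` when `q = ω(1 / n
^ 2)`. Unequal clusters and leftovers of the batching cost `o(n ^ 2 * q)` uncoded values. -/

/-! ### Linear slot codes and the cut-set bound. -/

section Coding

variable {V : Type*} [Fintype V] {K r : ℕ}

namespace Allocation

/-- The machine that reduces the vertex `v`. -/
noncomputable def reducer (A : Allocation V K r) (v : V) : Fin K := (A.reduce_cover v).choose

theorem mem_R_iff (A : Allocation V K r) {v : V} {k : Fin K} : v ∈ A.R k ↔ A.reducer v = k := by
  have h : v ∈ A.R (A.reducer v) := (A.reduce_cover v).choose_spec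
  refine ⟨fun hk => ?_, fun hk => hk ▸ h⟩
  by_contra hne
  exact Finset.disjoint_left.1 (A.reduce_disjoint _ _ hne) h hk

/-- The value of the ordered pair `(i, j)` is not available at the reducer of `i`. -/
def Missing (A : Allocation V K r) (i j : V) : Prop := j ∉ A.M (A.reducer i)

end Allocation

/-- A binary linear code in which every bit missing at its reducer is put into one slot, and each
slot carries the sum of its bits, is a feasible scheme as soon as the sender of a slot knows its
bits and the reducer of a bit knows all other bits in its slot. -/
theorem exists_shuffleScheme_of_slots (G : SimpleGraph V) (A : Allocation V K r) (T : ℕ)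
    {σ : Type*} [Fintype σ] (sender : σ → Fin K)
    (slot : {p : Present G // A.Missing p.1.1 p.1.2} × Fin T → σ)
    (hsender : ∀ b, b.1.1.1.2 ∈ A.M (sender (slot b)))
    (hslot : ∀ b b', slot b = slot b' → b ≠ b' → b'.1.1.1.2 ∈ A.M (A.reducer b.1.1.1.1)) :
    ∃ S : ShuffleScheme G A T, ∑ k, S.c k = Fintype.card σ := by
  classical
  let χ : Bool → ZMod 2 := fun b => if b then 1 else 0
  have hχ : ∀ z : ZMod 2, χ (decide (z = 1)) = z := by decide
  have hχ' : ∀ b : Bool, decide (χ b = 1) = b := by decide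
  let e : ∀ k, Fin (Fintype.card {s // sender s = k}) ≃ {s // sender s = k} :=
    fun k => (Fintype.equivFin _).symm
  -- The default `0` for unknown values is harmless: a sender knows every bit of its slot, and a
  -- receiver uses only the other bits, which it knows.
  let val : ∀ k, (Known G A k → Bits T) → {p : Present G // A.Missing p.1.1 p.1.2} × Fin T →
      ZMod 2 :=
    fun k loc b => if h : b.1.1.1.2 ∈ A.M k then χ (loc ⟨b.1.1, h⟩ b.2) else 0
  refine ⟨⟨fun k => Fintype.card {s // sender s = k},
    fun k loc m => decide ((∑ b with slot b = (e k m).1, val k loc b) = 1),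
    fun k loc msg p t =>
      let b : {p : Present G // A.Missing p.1.1 p.1.2} × Fin T := (⟨p.1, by
        have := A.mem_R_iff.1 p.2.1
        simpa [Allocation.Missing, this] using p.2.2⟩, t)
      if h : sender (slot b) ≠ k then
        decide (χ (msg ⟨_, h⟩ ((e _).symm ⟨slot b, rfl⟩)) -
          ∑ b' with slot b' = slot b ∧ b' ≠ b, val k loc b' = 1)
      -- This branch is never reached: the sender of a slot knows the bit that the receiver lacks,
      -- so the two machines differ.
      else false, ?_⟩, ?_⟩
  · intro v k
    funext p t
    have hk := A.mem_R_iff.1 p.2.1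
    set b : {p : Present G // A.Missing p.1.1 p.1.2} × Fin T := (⟨p.1, by
        simpa [Allocation.Missing, hk] using p.2.2⟩, t) with hb
    have hne : sender (slot b) ≠ k := by
      intro h
      have := hsender b
      rw [h] at this
      exact p.2.2 this
    have key : ∑ b' with slot b' = slot b, val (sender (slot b)) (fun p => v p.1) b' =
        χ (v p.1 t) + ∑ b' with slot b' = slot b ∧ b' ≠ b, val k (fun p => v p.1) b' := by
      have hmem : b ∈ Finset.univ.filter (fun b' => slot b' = slot b) := by simp
      rw [← Finset.add_sum_erase _ _ hmem]
      congr 1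
      · simp only [val]
        rw [dif_pos (hsender b)]
      · have : (Finset.univ.filter (fun b' => slot b' = slot b)).erase b =
            Finset.univ.filter (fun b' => slot b' = slot b ∧ b' ≠ b) := by
          ext b'
          simp only [Finset.mem_erase, Finset.mem_filter, Finset.mem_univ, true_and]
          exact and_comm
        rw [this]
        refine Finset.sum_congr rfl fun b' hb' => ?_
        simp only [Finset.mem_filter, Finset.mem_univ, true_and] at hb'
        have h1 := hsender b'
        rw [hb'.1] at h1
        have h2 := hslot b b' hb'.1.symm hb'.2.symm
        have h3 : A.reducer b.1.1.1.1 = k := hk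
        rw [h3] at h2
        simp only [val]
        rw [dif_pos h1, dif_pos h2]
    simp only
    rw [dif_pos hne]
    simp only [Equiv.apply_symm_apply]
    rw [hχ, key, add_sub_cancel_right, hχ']
  · simp only
    rw [← Fintype.card_sigma]
    exact Fintype.card_congr (Equiv.sigmaFiberEquiv sender)

theorem minBits_le_of_slots (G : SimpleGraph V) (A : Allocation V K r) (T : ℕ)
    {σ : Type*} [Fintype σ] (sender : σ → Fin K)
    (slot : {p : Present G // A.Missing p.1.1 p.1.2} × Fin T → σ)
    (hsender : ∀ b, b.1.1.1.2 ∈ A.M (sender (slot b)))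
    (hslot : ∀ b b', slot b = slot b' → b ≠ b' → b'.1.1.1.2 ∈ A.M (A.reducer b.1.1.1.1)) :
    minBits G A T ≤ Fintype.card σ :=
  Nat.sInf_le (exists_shuffleScheme_of_slots G A T sender slot hsender hslot)

/-- The minimum defining `minBits` is attained, since missing bits may be sent uncoded. -/
theorem exists_shuffleScheme_eq_minBits (G : SimpleGraph V) (A : Allocation V K r) (T : ℕ) :
    ∃ S : ShuffleScheme G A T, ∑ k, S.c k = minBits G A T := by
  classical
  refine Nat.sInf_mem (s := {b | ∃ S : ShuffleScheme G A T, ∑ k, S.c k = b}) ⟨_,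
    exists_shuffleScheme_of_slots G A T
      (σ := {p : Present G // A.Missing p.1.1 p.1.2} × Fin T)
      -- Every bit gets its own slot, so the compatibility condition is vacuous.
      (fun b => (A.map_cover b.1.1.1.2).choose) id
      (fun b => (A.map_cover b.1.1.1.2).choose_spec) (fun b b' h hne => (hne h).elim)⟩

open scoped Classical in
/-- Cut-set bound: the messages determine all values that are reduced but not mapped by the
machines in `S`, once the values mapped by these machines are fixed. -/
theorem card_cut_mul_le_minBits (G : SimpleGraph V) (A : Allocation V K r) (T : ℕ)
    (S : Finset (Fin K)) :
    (Finset.univ.filter fun p : V × V =>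
      G.Adj p.1 p.2 ∧ A.reducer p.1 ∈ S ∧ ∀ k ∈ S, p.2 ∉ A.M k).card * T ≤ minBits G A T := by
  obtain ⟨C, hC⟩ := exists_shuffleScheme_eq_minBits G A T
  rw [← hC]
  set P := Finset.univ.filter fun p : V × V =>
      G.Adj p.1 p.2 ∧ A.reducer p.1 ∈ S ∧ ∀ k ∈ S, p.2 ∉ A.M k with hP
  -- With zeros outside `P`, the local data of the machines in `S` do not depend on `u`, so the
  -- messages alone must separate the different `u`.
  let ext : (P → Bits T) → Present G → Bits T :=
    fun u p => if h : p.1 ∈ P then u ⟨p.1, h⟩ else fun _ => false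
  let F : (P → Bits T) → ∀ k, Bits (C.c k) := fun u k => C.encode k fun p => ext u p.1
  have hF : Function.Injective F := by
    intro u u' huu
    have hloc : ∀ k ∈ S, (fun p : Known G A k => ext u p.1) = fun p => ext u' p.1 := by
      intro k hk
      funext p
      have : p.1.1 ∉ P := by
        simp only [hP, Finset.mem_filter, not_and]
        intro _ _ _ h
        exact h k hk p.2
      simp only [ext]
      rw [dif_neg this, dif_neg this]
    funext p
    have hp := (Finset.mem_filter.1 p.2).2
    have h1 := C.correct (ext u) (A.reducer p.1.1)
    have h2 := C.correct (ext u') (A.reducer p.1.1)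
    have h3 : (fun l : {l : Fin K // l ≠ A.reducer p.1.1} =>
        C.encode l.1 fun p => ext u p.1) =
        fun l : {l : Fin K // l ≠ A.reducer p.1.1} => C.encode l.1 fun p => ext u' p.1 := by
      funext l
      exact congrFun huu l.1
    rw [hloc _ hp.2.1, h3, h2] at h1
    have h4 := congrFun h1 ⟨⟨p.1, hp.1⟩, A.mem_R_iff.2 rfl, hp.2.2 _ hp.2.1⟩
    simp only [ext] at h4
    rw [dif_pos p.2, dif_pos p.2] at h4
    exact h4.symm
  have hcard := Fintype.card_le_of_injective F hF
  have h2 : (Fintype.card ((P → Bits T))) = 2 ^ (P.card * T) := by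
    simp [Bits, ← pow_mul, mul_comm]
  have h3 : (Fintype.card (∀ k, Bits (C.c k))) = 2 ^ (∑ k, C.c k) := by
    simp [Bits, Finset.prod_pow_eq_pow_sum]
  rw [h2, h3] at hcard
  exact (Nat.pow_le_pow_iff_right (by norm_num)).1 hcard

end Coding

/-! ### First and second moments of Bernoulli random sets. -/

section RandomSet

variable {ι : Type*}

theorem setBernoulli_univ_real_subset (q : unitInterval) (F : Finset ι) :
    (setBernoulli (Set.univ : Set ι) q).real {E | ↑F ⊆ E} = (q : ℝ) ^ F.card := by
  have h : (fun p : ι → Prop => {i | p i}) ⁻¹' {E : Set ι | ↑F ⊆ E} =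
      (F : Set ι).pi fun _ => {True} := by
    ext p
    simp [Set.subset_def, Set.mem_pi]
  rw [measureReal_def, setBernoulli_apply', h,
    Measure.infinitePi_pi _ (fun _ _ => MeasurableSet.of_discrete)]
  simp

variable [Finite ι]

theorem integral_indicator_mem (q : unitInterval) (a : ι) :
    ∫ E : Set ι, E.indicator (1 : ι → ℝ) a ∂(setBernoulli Set.univ q) = q := by
  classical
  have h : (fun E : Set ι => E.indicator (1 : ι → ℝ) a) =
      Set.indicator {E : Set ι | ↑({a} : Finset ι) ⊆ E} 1 := by
    funext E
    simp [Set.indicator_apply]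
  rw [h, integral_indicator_one (Set.toFinite _).measurableSet, setBernoulli_univ_real_subset]
  simp

theorem integral_indicator_mem_mul (q : unitInterval) {a b : ι} (hab : a ≠ b) :
    ∫ E : Set ι, E.indicator (1 : ι → ℝ) a * E.indicator (1 : ι → ℝ) b
      ∂(setBernoulli Set.univ q) = (q : ℝ) ^ 2 := by
  classical
  have h : (fun E : Set ι => E.indicator (1 : ι → ℝ) a * E.indicator (1 : ι → ℝ) b) =
      Set.indicator {E : Set ι | ↑({a, b} : Finset ι) ⊆ E} 1 := by
    funext E
    by_cases ha : a ∈ E <;> by_cases hb : b ∈ E <;>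
      simp [ha, hb, Set.insert_subset_iff]
  rw [h, integral_indicator_one (Set.toFinite _).measurableSet, setBernoulli_univ_real_subset,
    Finset.card_pair hab]

/-- This is the variance bound: distinct elements are uncorrelated, and each diagonal term is `q - q
^ 2 ≤ q`. -/
theorem integral_sub_sq_le (q : unitInterval) (P : Finset ι) :
    ∫ E : Set ι, (∑ a ∈ P, E.indicator (1 : ι → ℝ) a - P.card * q) ^ 2
      ∂(setBernoulli Set.univ q) ≤ P.card * q := by
  classical
  have h : ∀ E : Set ι, (∑ a ∈ P, E.indicator (1 : ι → ℝ) a - P.card * q) ^ 2 =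
      ∑ a ∈ P, ∑ b ∈ P,
        (E.indicator (1 : ι → ℝ) a - q) * (E.indicator (1 : ι → ℝ) b - q) := by
    intro E
    rw [← Finset.sum_mul_sum, ← sq, Finset.sum_sub_distrib]
    simp
  have hcov : ∀ a ∈ P, ∀ b ∈ P, ∫ E : Set ι,
      (E.indicator (1 : ι → ℝ) a - q) * (E.indicator (1 : ι → ℝ) b - q)
        ∂(setBernoulli Set.univ q) ≤ if a = b then (q : ℝ) else 0 := by
    intro a _ b _
    have e : ∀ E : Set ι, (E.indicator (1 : ι → ℝ) a - q) * (E.indicator (1 : ι → ℝ) b - q) =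
        E.indicator (1 : ι → ℝ) a * E.indicator (1 : ι → ℝ) b - q * E.indicator (1 : ι → ℝ) a -
          q * E.indicator (1 : ι → ℝ) b + (q : ℝ) ^ 2 := by
      intro E; ring
    simp_rw [e]
    rw [integral_add Integrable.of_finite Integrable.of_finite,
      integral_sub Integrable.of_finite Integrable.of_finite,
      integral_sub Integrable.of_finite Integrable.of_finite, integral_const_mul,
      integral_const_mul, integral_indicator_mem, integral_indicator_mem]
    split_ifs with hab
    · subst hab
      have e2 : ∀ E : Set ι, E.indicator (1 : ι → ℝ) a * E.indicator (1 : ι → ℝ) a =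
          E.indicator (1 : ι → ℝ) a := by
        intro E
        by_cases ha : a ∈ E <;> simp [ha]
      simp_rw [e2]
      rw [integral_indicator_mem]
      simp
      nlinarith [q.2.1]
    · rw [integral_indicator_mem_mul q hab]
      simp
      nlinarith
  simp_rw [h]
  rw [integral_finsetSum _ fun _ _ => Integrable.of_finite]
  calc _ ≤ ∑ a ∈ P, (q : ℝ) := by
        refine Finset.sum_le_sum fun a ha => ?_
        rw [integral_finsetSum _ fun _ _ => Integrable.of_finite]
        calc _ ≤ ∑ b ∈ P, if a = b then (q : ℝ) else 0 :=
              Finset.sum_le_sum fun b hb => hcov a ha b hb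
          _ = q := by simp [ha]
    _ = P.card * q := by simp

end RandomSet

/-! ### Counting adjacent ordered pairs through the edge set. -/

section BipartiteCount

variable {n₁ n₂ : ℕ}

open scoped Classical in
/-- Every weighted count of adjacent ordered pairs is a linear combination of edge indicators. -/
theorem sum_adj_bipartiteGraph (E : Set (Fin n₁ × Fin n₂))
    (f : (Fin n₁ ⊕ Fin n₂) × (Fin n₁ ⊕ Fin n₂) → ℝ) :
    ∑ p, (if (bipartiteGraph E).Adj p.1 p.2 then f p else 0) =
      ∑ e : Fin n₁ × Fin n₂, E.indicator (1 : Fin n₁ × Fin n₂ → ℝ) e *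
        (f (Sum.inl e.1, Sum.inr e.2) + f (Sum.inr e.2, Sum.inl e.1)) := by
  have h12 : ∀ a b, (bipartiteGraph E).Adj (Sum.inl a) (Sum.inr b) ↔ (a, b) ∈ E := by
    intro a b; simp [bipartiteGraph]
  have h21 : ∀ a b, (bipartiteGraph E).Adj (Sum.inr b) (Sum.inl a) ↔ (a, b) ∈ E := by
    intro a b; simp [bipartiteGraph]
  have h11 : ∀ a b, ¬ (bipartiteGraph E).Adj (Sum.inl a) (Sum.inl b) := by
    intro a b; simp [bipartiteGraph]
  have h22 : ∀ a b, ¬ (bipartiteGraph E).Adj (Sum.inr a) (Sum.inr b) := by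
    intro a b; simp [bipartiteGraph]
  simp only [mul_add, Finset.sum_add_distrib, Fintype.sum_prod_type, Fintype.sum_sum_type, h12,
    h21, h11, h22, if_false, Finset.sum_const_zero, zero_add, add_zero, Set.indicator_apply,
    Pi.one_apply, ite_mul, one_mul, zero_mul]
  rw [add_comm]
  refine congrArg₂ (· + ·) rfl ?_
  rw [Finset.sum_comm]

open scoped Classical in
theorem integral_sum_adj_bipartiteGraph (q : unitInterval)
    (f : (Fin n₁ ⊕ Fin n₂) × (Fin n₁ ⊕ Fin n₂) → ℝ) :
    ∫ E : Set (Fin n₁ × Fin n₂), ∑ p, (if (bipartiteGraph E).Adj p.1 p.2 then f p else 0)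
        ∂(setBernoulli Set.univ q) =
      q * ∑ e : Fin n₁ × Fin n₂,
        (f (Sum.inl e.1, Sum.inr e.2) + f (Sum.inr e.2, Sum.inl e.1)) := by
  simp_rw [sum_adj_bipartiteGraph]
  rw [integral_finsetSum _ fun _ _ => Integrable.of_finite, Finset.mul_sum]
  refine Finset.sum_congr rfl fun e _ => ?_
  rw [integral_mul_const, integral_indicator_mem]

end BipartiteCount

/-! ### The lower bound by averaged cut sets. -/

section Converse

/-- The probability that a random set, which contains each machine independently with
probability `x`, contains `k` and avoids `B`. -/
theorem sum_subsets_mem_disjoint {κ : Type*} [Fintype κ] [DecidableEq κ] (x : ℝ) (k : κ)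
    (B : Finset κ) :
    ∑ S : Finset κ, (x ^ S.card * (1 - x) ^ (Sᶜ).card) *
        (if k ∈ S ∧ Disjoint S B then 1 else 0) =
      if k ∈ B then 0 else x * (1 - x) ^ B.card := by
  -- Expanding this product over subsets `S` of chosen first summands, the zeros on `B` kill every
  -- `S` that meets `B`, and the zero at `k` kills every `S` that omits `k`.
  have h := Fintype.prod_add (fun a => if a ∈ B then 0 else x) (fun a => if a = k then 0 else 1 - x)
  have h1 : ∀ S : Finset κ, (∏ a ∈ S, if a ∈ B then 0 else x) *
      (∏ a ∈ Sᶜ, if a = k then 0 else 1 - x) = (x ^ S.card * (1 - x) ^ (Sᶜ).card) *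
        (if k ∈ S ∧ Disjoint S B then 1 else 0) := by
    intro S
    by_cases hk : k ∈ S
    · by_cases hd : Disjoint S B
      · rw [if_pos ⟨hk, hd⟩, mul_one]
        congr 1
        · rw [← Finset.prod_const]
          exact Finset.prod_congr rfl fun a ha => if_neg (Finset.disjoint_left.1 hd ha)
        · rw [← Finset.prod_const]
          refine Finset.prod_congr rfl fun a ha => if_neg ?_
          rintro rfl
          exact (Finset.mem_compl.1 ha) hk
      · rw [if_neg (fun h => hd h.2), mul_zero]
        obtain ⟨a, ha, hb⟩ := Finset.not_disjoint_iff.1 hd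
        have h0 : (∏ a ∈ S, if a ∈ B then 0 else x) = 0 := Finset.prod_eq_zero ha (if_pos hb)
        rw [h0, zero_mul]
    · have h0 : (∏ a ∈ Sᶜ, if a = k then 0 else 1 - x) = 0 :=
        Finset.prod_eq_zero (Finset.mem_compl.2 hk) (if_pos rfl)
      rw [if_neg (fun h => hk h.1), mul_zero, h0, mul_zero]
  simp_rw [h1] at h
  rw [← h]
  split_ifs with hk
  · exact Finset.prod_eq_zero (Finset.mem_univ k) (by simp [hk])
  · have h2 : ∀ a, ((if a ∈ B then 0 else x) + (if a = k then 0 else 1 - x)) =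
        (if a = k then x else 1) * (if a ∈ B then 1 - x else 1) := by
      intro a
      by_cases hak : a = k
      · subst hak; simp [hk]
      · by_cases hb : a ∈ B <;> simp [hak, hb]
    simp_rw [h2]
    rw [Finset.prod_mul_distrib]
    simp

variable {V : Type*} [Fintype V] {K r : ℕ}

namespace Allocation

open scoped Classical in
/-- The machines that map the vertex `v`. -/
noncomputable def mappers (A : Allocation V K r) (v : V) : Finset (Fin K) :=
  Finset.univ.filter fun k => v ∈ A.M k

open scoped Classical in
theorem mem_mappers {A : Allocation V K r} {v : V} {k : Fin K} :
    k ∈ A.mappers v ↔ v ∈ A.M k := by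
  simp [mappers]

theorem sum_card_mappers (A : Allocation V K r) (hK : 0 < K) :
    ∑ v, ((A.mappers v).card : ℝ) = r * Fintype.card V := by
  classical
  have h1 : ∑ v, (A.mappers v).card = ∑ k, (A.M k).card := by
    have := Finset.sum_card_bipartiteAbove_eq_sum_card_bipartiteBelow
      (s := (Finset.univ : Finset V)) (t := (Finset.univ : Finset (Fin K)))
      (fun v k => v ∈ A.M k)
    simpa [Finset.bipartiteAbove, Finset.bipartiteBelow, mappers] using this
  have h2 : K * ∑ k, (A.M k).card = K * (r * Fintype.card V) := by
    rw [Finset.mul_sum, Finset.sum_congr rfl fun k _ => A.map_card k]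
    simp
  have h3 := Nat.eq_of_mul_eq_mul_left hK h2
  rw [← Nat.cast_sum, h1, h3]
  push_cast
  ring

open scoped Classical in
theorem card_reducer_mem (A : Allocation V K r) (hK : 0 < K) (B : Finset (Fin K)) :
    ((Finset.univ.filter fun v => A.reducer v ∈ B).card : ℝ) =
      B.card * ((Fintype.card V : ℝ) / K) := by
  have h1 : Finset.univ.filter (fun v => A.reducer v ∈ B) = B.biUnion A.R := by
    ext v
    simp [mem_R_iff]
  rw [h1, Finset.card_biUnion fun k _ l _ hkl => A.reduce_disjoint k l hkl]
  push_cast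
  have h2 : ∀ k, ((A.R k).card : ℝ) = (Fintype.card V : ℝ) / K := by
    intro k
    have hK' : (K : ℝ) ≠ 0 := by positivity
    rw [eq_div_iff hK', mul_comm]
    exact_mod_cast A.reduce_card k
  simp [h2]

end Allocation

open scoped Classical in
/-- Average of the cut-set bound over a random set of machines. -/
theorem weighted_cut_le_minBits (G : SimpleGraph V) (A : Allocation V K r) (T : ℕ) {x : ℝ}
    (hx0 : 0 ≤ x) (hx1 : x ≤ 1) :
    T * ∑ p : V × V, (if G.Adj p.1 p.2 then
      (if A.Missing p.1 p.2 then x * (1 - x) ^ (A.mappers p.2).card else 0) else 0) ≤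
      minBits G A T := by
  have hw : ∑ S : Finset (Fin K), x ^ S.card * (1 - x) ^ (Sᶜ).card = 1 := by
    have := Fintype.prod_add (fun _ : Fin K => x) (fun _ => 1 - x)
    simpa using this.symm
  have hcut : ∀ S : Finset (Fin K), (T : ℝ) * ∑ p : V × V, (if G.Adj p.1 p.2 then
      (if A.reducer p.1 ∈ S ∧ Disjoint S (A.mappers p.2) then 1 else 0) else 0) ≤
      minBits G A T := by
    intro S
    have h := card_cut_mul_le_minBits G A T S
    rw [Finset.card_filter] at h
    have h' : ((∑ p : V × V, if G.Adj p.1 p.2 ∧ A.reducer p.1 ∈ S ∧ ∀ k ∈ S, p.2 ∉ A.M k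
        then 1 else 0 : ℕ) : ℝ) * T ≤ minBits G A T := by exact_mod_cast h
    rw [mul_comm]
    refine le_trans (le_of_eq ?_) h'
    congr 1
    push_cast
    refine Finset.sum_congr rfl fun p _ => ?_
    rw [← ite_and]
    simp only [Finset.disjoint_left, Allocation.mem_mappers]
  calc _ = ∑ S : Finset (Fin K), x ^ S.card * (1 - x) ^ (Sᶜ).card *
        (T * ∑ p : V × V, (if G.Adj p.1 p.2 then
          (if A.reducer p.1 ∈ S ∧ Disjoint S (A.mappers p.2) then (1 : ℝ) else 0) else 0)) := by
        simp_rw [Finset.mul_sum]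
        rw [Finset.sum_comm]
        refine Finset.sum_congr rfl fun p _ => ?_
        split_ifs with h1 h2
        · have := sum_subsets_mem_disjoint x (A.reducer p.1) (A.mappers p.2)
          rw [if_neg (by rw [Allocation.mem_mappers]; exact h2)] at this
          refine (congrArg ((T : ℝ) * ·) this.symm).trans ?_
          simp only [Finset.mul_sum]
          exact Finset.sum_congr rfl fun _ _ => by ring
        · have := sum_subsets_mem_disjoint x (A.reducer p.1) (A.mappers p.2)
          rw [if_pos (by rw [Allocation.mem_mappers]; exact not_not.1 h2)] at this
          refine (congrArg ((T : ℝ) * ·) this.symm).trans ?_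
          simp only [Finset.mul_sum]
          exact Finset.sum_congr rfl fun _ _ => by ring
        · simp
    _ ≤ ∑ S : Finset (Fin K), x ^ S.card * (1 - x) ^ (Sᶜ).card * minBits G A T := by
        refine Finset.sum_le_sum fun S _ => mul_le_mul_of_nonneg_left (hcut S) ?_
        have : 0 ≤ 1 - x := by linarith
        positivity
    _ = minBits G A T := by rw [← Finset.sum_mul, hw, one_mul]

/-- The tangent at `m = r` of the function bounding the number of values missing per vertex. -/
theorem tangent_le_max_mul_pow {K r : ℕ} (hr : 1 ≤ r) (hrK : 2 * r < K) (m : ℕ) :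
    (1 - 2 * r / K) / 2 - ((m : ℝ) - r) / (2 * r) ≤
      max 0 (1 - 2 * (m : ℝ) / K) * (1 - 1 / (2 * (r : ℝ))) ^ m := by
  have hr' : (1 : ℝ) ≤ r := by exact_mod_cast hr
  have hK' : (2 : ℝ) * r < K := by exact_mod_cast hrK
  have hK0 : (0 : ℝ) < K := by linarith
  have hx : 1 / (2 * (r : ℝ)) ≤ 1 := by
    rw [div_le_one (by positivity)]; linarith
  rcases le_total (K : ℝ) (2 * m) with h | h
  · have h1 : (1 - 2 * (r : ℝ) / K) / 2 - ((m : ℝ) - r) / (2 * r) ≤ 0 := by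
      have e : (1 - 2 * (r : ℝ) / K) / 2 - ((m : ℝ) - r) / (2 * r) =
          (r * (K - 2 * r) - K * (m - r)) / (2 * r * K) := by field_simp
      rw [e]
      apply div_nonpos_of_nonpos_of_nonneg _ (by positivity)
      nlinarith
    refine h1.trans (mul_nonneg (le_max_left _ _) (pow_nonneg (by linarith) _))
  · have h0 : 0 ≤ 1 - 2 * (m : ℝ) / K := by
      rw [sub_nonneg, div_le_one hK0]; exact h
    rw [max_eq_right h0]
    have hB : 1 - (m : ℝ) * (1 / (2 * r)) ≤ (1 - 1 / (2 * (r : ℝ))) ^ m := by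
      have := one_add_mul_le_pow (a := -(1 / (2 * (r : ℝ)))) (by linarith) m
      rw [← sub_eq_add_neg] at this
      linarith
    refine le_trans ?_ (mul_le_mul_of_nonneg_left hB h0)
    -- After Bernoulli's inequality the bound is a quadratic in `m`, which exceeds its tangent at
    -- `r` by a perfect square over `r * K`.
    have e : (1 - 2 * (m : ℝ) / K) * (1 - m * (1 / (2 * r))) -
        ((1 - 2 * (r : ℝ) / K) / 2 - ((m : ℝ) - r) / (2 * r)) = (m - r) ^ 2 / (r * K) := by
      field_simp; ring
    have : 0 ≤ ((m : ℝ) - r) ^ 2 / (r * K) := by positivity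
    linarith

open scoped Classical in
-- Here `g` lists the cluster opposite to `j`, and `d` measures how far its size may fall below half
-- of the vertices. Each machine mapping `j` spares only the vertices it reduces. The deficit costs
-- at most `d`, because the weight of a pair is at most `1`.
theorem sum_missing_ge (A : Allocation V K r) (hr : 1 ≤ r) (hrK : 2 * r < K)
    {ι : Type*} [Fintype ι] (g : ι → V) (hg : Function.Injective g) (j : V) {d : ℝ} (hd0 : 0 ≤ d)
    (hd : (Fintype.card V : ℝ) / 2 - d ≤ Fintype.card ι) :
    (Fintype.card V : ℝ) / 2 * (1 / (2 * r)) *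
        ((1 - 2 * r / K) / 2 - (((A.mappers j).card : ℝ) - r) / (2 * r)) - d ≤
      ∑ i, if A.Missing (g i) j then 1 / (2 * (r : ℝ)) * (1 - 1 / (2 * r)) ^ (A.mappers j).card
        else 0 := by
  have hr' : (1 : ℝ) ≤ r := by exact_mod_cast hr
  have hK' : (2 : ℝ) * r < K := by exact_mod_cast hrK
  have hK0 : (0 : ℝ) < K := by linarith
  have hx : 1 / (2 * (r : ℝ)) ≤ 1 := by
    rw [div_le_one (by positivity)]; linarith
  set x := 1 / (2 * (r : ℝ)) with hxd
  have hx0 : 0 < x := by positivity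
  set m := (A.mappers j).card with hm
  set n : ℝ := (Fintype.card V : ℝ) with hn
  have hcount : max 0 (Fintype.card ι - m * (n / K)) ≤
      ((Finset.univ.filter fun i => A.Missing (g i) j).card : ℝ) := by
    refine max_le (by positivity) ?_
    have h1 := Finset.card_filter_add_card_filter_not (s := (Finset.univ : Finset ι))
      (p := fun i => A.Missing (g i) j)
    have h2 : (Finset.univ.filter fun i => ¬ A.Missing (g i) j).card ≤
        (Finset.univ.filter fun v => A.reducer v ∈ A.mappers j).card := by
      refine Finset.card_le_card_of_injOn g ?_ hg.injOn
      intro i hi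
      simpa [Allocation.Missing, Allocation.mem_mappers] using hi
    have h3 := A.card_reducer_mem (by omega) (A.mappers j)
    have h2' : ((Finset.univ.filter fun i => ¬ A.Missing (g i) j).card : ℝ) ≤ m * (n / K) := by
      rw [← h3]; exact_mod_cast h2
    have h1' : ((Finset.univ.filter fun i => A.Missing (g i) j).card : ℝ) +
        (Finset.univ.filter fun i => ¬ A.Missing (g i) j).card = Fintype.card ι := by
      exact_mod_cast h1
    linarith
  have hmax : n / 2 * max 0 (1 - 2 * (m : ℝ) / K) - d ≤ max 0 (Fintype.card ι - m * (n / K)) := by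
    have hn0 : 0 ≤ n / 2 := by positivity
    rw [mul_max_of_nonneg _ _ hn0, mul_zero]
    have e : n / 2 * (1 - 2 * (m : ℝ) / K) = n / 2 - m * (n / K) := by field_simp
    rw [e]
    rcases le_total 0 (n / 2 - m * (n / K)) with h | h
    · rw [max_eq_right h]
      exact le_trans (by linarith) (le_max_right _ _)
    · rw [max_eq_left h]
      exact le_trans (by linarith) (le_max_left _ _)
  have hpow0 : 0 ≤ (1 - x) ^ m := pow_nonneg (by linarith) _
  have hpow1 : (1 - x) ^ m ≤ 1 := pow_le_one₀ (by linarith) (by linarith)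
  have hxp : x * (1 - x) ^ m ≤ 1 := mul_le_one₀ hx hpow0 hpow1
  rw [← Finset.sum_filter, Finset.sum_const, nsmul_eq_mul]
  calc _ ≤ n / 2 * x * (max 0 (1 - 2 * (m : ℝ) / K) * (1 - x) ^ m) - d := by
        have := tangent_le_max_mul_pow hr hrK m
        have hc : 0 ≤ n / 2 * x := by positivity
        exact sub_le_sub_right (mul_le_mul_of_nonneg_left this hc) _
    _ ≤ n / 2 * x * (max 0 (1 - 2 * (m : ℝ) / K) * (1 - x) ^ m) - d * (x * (1 - x) ^ m) := by
        nlinarith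
    _ = (n / 2 * max 0 (1 - 2 * (m : ℝ) / K) - d) * (x * (1 - x) ^ m) := by ring
    _ ≤ _ := mul_le_mul_of_nonneg_right (hmax.trans hcount) (by positivity)

/-- The converse for a fixed allocation. -/
theorem le_integral_commLoad {n₁ n₂ T : ℕ} (q : unitInterval) (hT : 0 < T) (hr : 1 ≤ r)
    (hrK : 2 * r < K) (hn : 0 < n₁ + n₂) (A : Allocation (Fin n₁ ⊕ Fin n₂) K r) :
    (q : ℝ) * (1 / (8 * r) * (1 - 2 * r / K) - |(n₁ : ℝ) - n₂| / ((n₁ + n₂ : ℕ) : ℝ)) ≤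
      ∫ E : Set (Fin n₁ × Fin n₂), commLoad (bipartiteGraph E) A T
        ∂(setBernoulli Set.univ q) := by
  classical
  have hr' : (1 : ℝ) ≤ r := by exact_mod_cast hr
  have hK' : (2 : ℝ) * r < K := by exact_mod_cast hrK
  have hx : 1 / (2 * (r : ℝ)) ≤ 1 := by
    rw [div_le_one (by positivity)]; linarith
  set n : ℝ := ((n₁ + n₂ : ℕ) : ℝ) with hnd
  have hn0 : 0 < n := by rw [hnd]; exact_mod_cast hn
  have hnn : n = n₁ + n₂ := by rw [hnd]; push_cast; ring
  have hcard : ((Fintype.card (Fin n₁ ⊕ Fin n₂) : ℕ) : ℝ) = n := by simp [hnd]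
  have hT0 : (0 : ℝ) < T := by exact_mod_cast hT
  set D := |(n₁ : ℝ) - n₂| with hD
  have hD0 : 0 ≤ D := abs_nonneg _
  let f : (Fin n₁ ⊕ Fin n₂) × (Fin n₁ ⊕ Fin n₂) → ℝ := fun p =>
    if A.Missing p.1 p.2 then 1 / (2 * (r : ℝ)) * (1 - 1 / (2 * r)) ^ (A.mappers p.2).card else 0
  have hmain : n ^ 2 * (1 / (8 * r) * (1 - 2 * r / K)) - n * D ≤ ∑ e : Fin n₁ × Fin n₂,
        (f (Sum.inl e.1, Sum.inr e.2) + f (Sum.inr e.2, Sum.inl e.1)) := by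
    let h : Fin n₁ ⊕ Fin n₂ → ℝ := fun j => n / 2 * (1 / (2 * r)) *
        ((1 - 2 * r / K) / 2 - (((A.mappers j).card : ℝ) - r) / (2 * r)) - D
    -- The numbers of mappers sum to `r * n`, so the linear terms of the tangent cancel.
    have hsum : ∑ j, h j = n ^ 2 * (1 / (8 * r) * (1 - 2 * r / K)) - n * D := by
      have hs := A.sum_card_mappers (by omega)
      rw [hcard] at hs
      simp only [h]
      rw [Finset.sum_sub_distrib, ← Finset.mul_sum, Finset.sum_sub_distrib, ← Finset.sum_div,
        ← Finset.sum_div _ (fun j => ((A.mappers j).card : ℝ) - r), Finset.sum_sub_distrib,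
        Finset.sum_sub_distrib, hs]
      simp only [Finset.sum_const, Finset.card_univ, nsmul_eq_mul, hcard]
      field_simp
      ring
    rw [← hsum, Fintype.sum_sum_type, Finset.sum_add_distrib, add_comm]
    have hdl : n / 2 - D ≤ n₁ := by
      have := neg_abs_le ((n₁ : ℝ) - n₂)
      rw [hnn]; linarith
    have hdr : n / 2 - D ≤ n₂ := by
      have := le_abs_self ((n₁ : ℝ) - n₂)
      rw [hnn]; linarith
    refine add_le_add ?_ ?_
    · rw [Fintype.sum_prod_type_right]
      refine Finset.sum_le_sum fun j _ => ?_
      have := sum_missing_ge A hr hrK (Sum.inl : Fin n₁ → Fin n₁ ⊕ Fin n₂) Sum.inl_injective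
        (Sum.inr j) hD0 (by rw [hcard]; simpa using hdl)
      rw [hcard] at this
      exact this
    · rw [Fintype.sum_prod_type]
      refine Finset.sum_le_sum fun j _ => ?_
      have := sum_missing_ge A hr hrK (Sum.inr : Fin n₂ → Fin n₁ ⊕ Fin n₂) Sum.inr_injective
        (Sum.inl j) hD0 (by rw [hcard]; simpa using hdr)
      rw [hcard] at this
      exact this
  have hpt : ∀ E : Set (Fin n₁ × Fin n₂),
      (∑ p, (if (bipartiteGraph E).Adj p.1 p.2 then f p else 0)) / n ^ 2 ≤
        commLoad (bipartiteGraph E) A T := by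
    intro E
    -- The choice `x = 1 / (2 * r)` maximizes `x * (1 - r * x)`, the Bernoulli lower bound for `x *
    -- (1 - x) ^ r`.
    have := weighted_cut_le_minBits (bipartiteGraph E) A T (x := 1 / (2 * (r : ℝ)))
      (by positivity) hx
    rw [commLoad, hcard, div_le_div_iff₀ (by positivity) (by positivity)]
    calc _ = (T * ∑ p, (if (bipartiteGraph E).Adj p.1 p.2 then f p else 0)) * n ^ 2 := by ring
      _ ≤ _ := mul_le_mul_of_nonneg_right this (by positivity)
  calc _ = (q : ℝ) * (n ^ 2 * (1 / (8 * r) * (1 - 2 * r / K)) - n * D) / n ^ 2 := by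
        field_simp
    _ ≤ (q * ∑ e : Fin n₁ × Fin n₂,
        (f (Sum.inl e.1, Sum.inr e.2) + f (Sum.inr e.2, Sum.inl e.1))) / n ^ 2 := by
        gcongr
        exact q.2.1
    _ = ∫ E : Set (Fin n₁ × Fin n₂),
        (∑ p, (if (bipartiteGraph E).Adj p.1 p.2 then f p else 0)) / n ^ 2
          ∂(setBernoulli Set.univ q) := by
        rw [integral_div, integral_sum_adj_bipartiteGraph]
    _ ≤ _ := integral_mono Integrable.of_finite Integrable.of_finite hpt

end Converse

/-! ### Coded multicasting within groups of `r + 1` machines. -/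

section CodedScheme

variable {V : Type*} [Fintype V] {K r : ℕ}

open scoped Classical in
/-- The ordered pairs whose values are reduced by `k` and served within the group `S` of
machines. -/
noncomputable def codedPairs (A : Allocation V K r) (batch : V → Finset (Fin K))
    (Good : V → V → Prop) (S : Finset (Fin K)) (k : Fin K) : Finset (V × V) :=
  Finset.univ.filter fun p => Good p.1 p.2 ∧ A.reducer p.1 = k ∧ k ∉ batch p.2 ∧
    insert k (batch p.2) = S

open scoped Classical in
/-- The coded scheme: within each group `S` of `r + 1` machines, the values needed by one member
are known to all others, so that every member multicasts sums of bits that are each wanted by one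
other member. Pairs that are not good are served uncoded. -/
theorem minBits_le_coded (G : SimpleGraph V) (A : Allocation V K r) (T : ℕ)
    (batch : V → Finset (Fin K)) (Good : V → V → Prop) (𝒮 : Finset (Finset (Fin K)))
    (w : Finset (Fin K) → ℕ)
    (hmap : ∀ j, ∀ l ∈ batch j, j ∈ A.M l)
    (hcard : ∀ S ∈ 𝒮, S.card = r + 1)
    (hgroup : ∀ i j, Good i j → A.reducer i ∉ batch j → insert (A.reducer i) (batch j) ∈ 𝒮)
    (hw : ∀ S ∈ 𝒮, ∀ k ∈ S,
      ((codedPairs A batch Good S k).filter fun p => G.Adj p.1 p.2).card * T ≤ r * w S) :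
    minBits G A T ≤ (Finset.univ.filter fun p : V × V => G.Adj p.1 p.2 ∧ ¬ Good p.1 p.2).card * T +
      (r + 1) * ∑ S ∈ 𝒮, w S := by
  -- The bits wanted by `k` in the group `S` are placed injectively into pairs of one of the `r`
  -- other members, as sender, and one of its `w S` positions; `hw` says that there is room.
  have hφ : ∀ S k, ∃ f : (V × V) × Fin T → Fin K × ℕ, S ∈ 𝒮 → k ∈ S →
      (∀ b : (V × V) × Fin T, b.1 ∈ (codedPairs A batch Good S k).filter (fun p => G.Adj p.1 p.2) →
        f b ∈ (S.erase k) ×ˢ Finset.range (w S)) ∧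
      Set.InjOn f {b | b.1 ∈ (codedPairs A batch Good S k).filter (fun p => G.Adj p.1 p.2)} := by
    intro S k
    by_cases hS : S ∈ 𝒮 ∧ k ∈ S
    · have : Nonempty (Fin K × ℕ) := ⟨(k, 0)⟩
      have hle : (((codedPairs A batch Good S k).filter (fun p => G.Adj p.1 p.2)) ×ˢ
          (Finset.univ : Finset (Fin T))).card ≤ ((S.erase k) ×ˢ Finset.range (w S)).card := by
        rw [Finset.card_product, Finset.card_product, Finset.card_erase_of_mem hS.2,
          hcard S hS.1]
        simpa using hw S hS.1 k hS.2
      have hle' : ((((codedPairs A batch Good S k).filter (fun p => G.Adj p.1 p.2)) ×ˢ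
          (Finset.univ : Finset (Fin T)) : Finset _) : Set ((V × V) × Fin T)).encard ≤
          (((S.erase k) ×ˢ Finset.range (w S) : Finset _) : Set (Fin K × ℕ)).encard := by
        rw [Set.encard_coe_eq_coe_finsetCard, Set.encard_coe_eq_coe_finsetCard]
        exact_mod_cast hle
      obtain ⟨f, hf, hinj⟩ :=
        Set.Finite.exists_injOn_of_encard_le (Finset.finite_toSet _) hle'
      refine ⟨f, fun _ _ => ⟨fun b hb => ?_, fun b hb b' hb' => hinj ?_ ?_⟩⟩
      · exact hf (by simpa using hb)
      · simpa using hb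
      · simpa using hb'
    · exact ⟨fun b => (k, 0), fun h1 h2 => (hS ⟨h1, h2⟩).elim⟩
  choose φ hφ using hφ
  let B := {p : Present G // A.Missing p.1.1 p.1.2} × Fin T
  let grp : B → Finset (Fin K) := fun b => insert (A.reducer b.1.1.1.1) (batch b.1.1.1.2)
  have hnot : ∀ b : B, A.reducer b.1.1.1.1 ∉ batch b.1.1.1.2 :=
    fun b h => b.1.2 (hmap _ _ h)
  let code : B → Fin K × ℕ := fun b => φ (grp b) (A.reducer b.1.1.1.1) (b.1.1.1, b.2)
  let Bad := {p : V × V // p ∈ Finset.univ.filter fun p : V × V => G.Adj p.1 p.2 ∧ ¬ Good p.1 p.2}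
  let σ := (Bad × Fin T) ⊕
    {x : (_ : Finset (Fin K)) × (Fin K × ℕ) // x ∈ 𝒮.sigma fun S => S ×ˢ Finset.range (w S)}
  have hmem : ∀ b : B, Good b.1.1.1.1 b.1.1.1.2 → grp b ∈ 𝒮 ∧
      b.1.1.1 ∈ (codedPairs A batch Good (grp b) (A.reducer b.1.1.1.1)).filter
        (fun p => G.Adj p.1 p.2) := by
    intro b hb
    refine ⟨hgroup _ _ hb (hnot b), ?_⟩
    exact Finset.mem_filter.2 ⟨Finset.mem_filter.2 ⟨Finset.mem_univ _, hb, rfl, hnot b, rfl⟩, b.1.1.2⟩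
  have hcode : ∀ b : B, Good b.1.1.1.1 b.1.1.1.2 → code b ∈
      ((grp b).erase (A.reducer b.1.1.1.1)) ×ˢ Finset.range (w (grp b)) := by
    intro b hb
    exact (hφ _ _ (hmem b hb).1 (Finset.mem_insert_self _ _)).1 _ (hmem b hb).2
  let slot : B → σ := fun b =>
    if hb : Good b.1.1.1.1 b.1.1.1.2 then
      Sum.inr ⟨⟨grp b, code b⟩, Finset.mem_sigma.2 ⟨(hmem b hb).1,
        Finset.product_subset_product_left (Finset.erase_subset _ _) (hcode b hb)⟩⟩
    else Sum.inl (⟨b.1.1.1, by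
      simp only [Finset.mem_filter, Finset.mem_univ, true_and]; exact ⟨b.1.1.2, hb⟩⟩, b.2)
  let sender : σ → Fin K := fun x =>
    match x with
    | Sum.inl p => (A.map_cover p.1.1.2).choose
    | Sum.inr y => y.1.2.1
  have key := minBits_le_of_slots G A T sender slot ?_ ?_
  · refine key.trans (le_of_eq ?_)
    simp only [σ, Bad, Fintype.card_sum, Fintype.card_prod, Fintype.card_coe, Fintype.card_fin,
      Finset.card_sigma, Finset.card_product, Finset.card_range]
    rw [Finset.mul_sum]
    congr 1
    exact Finset.sum_congr rfl fun S hS => by rw [hcard S hS]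
  · intro b
    by_cases hb : Good b.1.1.1.1 b.1.1.1.2
    · have e : sender (slot b) = (code b).1 := by
        simp only [slot]; rw [dif_pos hb]
      rw [e]
      -- The sender lies in the group without the receiver, which is exactly the batch of machines
      -- that map the file.
      have h1 := (Finset.mem_product.1 (hcode b hb)).1
      rw [Finset.erase_insert (hnot b)] at h1
      exact hmap _ _ h1
    · have e : sender (slot b) = (A.map_cover b.1.1.1.2).choose := by
        simp only [slot]; rw [dif_neg hb]
      rw [e]
      exact (A.map_cover b.1.1.1.2).choose_spec
  · intro b b' h hne
    by_cases hb : Good b.1.1.1.1 b.1.1.1.2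
    · by_cases hb' : Good b'.1.1.1.1 b'.1.1.1.2
      · simp only [slot] at h
        rw [dif_pos hb, dif_pos hb'] at h
        have h' := congrArg Subtype.val (Sum.inr.inj h)
        have hg : grp b = grp b' := congrArg Sigma.fst h'
        have hc : code b = code b' := congrArg (fun x => x.2) h'
        -- Bits in one slot with the same receiver coincide by injectivity of `φ`. With different
        -- receivers, each receiver belongs to the batch of the other bit and so knows it.
        by_cases hk : A.reducer b.1.1.1.1 = A.reducer b'.1.1.1.1
        · exfalso
          apply hne
          have m1 := (hmem b hb).2
          have m2 := (hmem b' hb').2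
          simp only [code] at hc
          rw [← hg, ← hk] at hc m2
          have := (hφ _ _ (hmem b hb).1 (Finset.mem_insert_self _ _)).2 m1 m2 hc
          have e1 := congrArg Prod.fst this
          have e2 := congrArg Prod.snd this
          exact Prod.ext (Subtype.ext (Subtype.ext e1)) e2
        · have h3 : A.reducer b.1.1.1.1 ∈ grp b' := by
            rw [← hg]; exact Finset.mem_insert_self _ _
          exact hmap _ _ ((Finset.mem_insert.1 h3).resolve_left hk)
      · simp only [slot] at h
        rw [dif_pos hb, dif_neg hb'] at h
        cases h
    · by_cases hb' : Good b'.1.1.1.1 b'.1.1.1.2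
      · simp only [slot] at h
        rw [dif_neg hb, dif_pos hb'] at h
        cases h
      · simp only [slot] at h
        rw [dif_neg hb, dif_neg hb'] at h
        have h' := Sum.inl.inj h
        have e1 := congrArg (fun x => x.1.1) h'
        have e2 := congrArg Prod.snd h'
        exact (hne (Prod.ext (Subtype.ext (Subtype.ext e1)) e2)).elim

end CodedScheme

/-! ### Expected maximum of finitely many edge counts. -/

section Concentration

variable {n₁ n₂ : ℕ}

open scoped Classical in
-- The count splits by orientation into two Bernoulli sums. These may share edges and so be
-- dependent, whence `(a + b) ^ 2 ≤ 2 * a ^ 2 + 2 * b ^ 2` and the factor `2`.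
theorem exists_mean_integral_sub_sq_le (q : unitInterval)
    (Q : Finset ((Fin n₁ ⊕ Fin n₂) × (Fin n₁ ⊕ Fin n₂))) {N : ℝ} (hN : (Q.card : ℝ) ≤ N) :
    ∃ μ : ℝ, μ ≤ N * q ∧ ∫ E : Set (Fin n₁ × Fin n₂),
      (((Q.filter fun p => (bipartiteGraph E).Adj p.1 p.2).card : ℝ) - μ) ^ 2
        ∂(setBernoulli Set.univ q) ≤ 2 * (N * q) := by
  let P₁ : Finset (Fin n₁ × Fin n₂) := Finset.univ.filter fun e => (Sum.inl e.1, Sum.inr e.2) ∈ Q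
  let P₂ : Finset (Fin n₁ × Fin n₂) := Finset.univ.filter fun e => (Sum.inr e.2, Sum.inl e.1) ∈ Q
  have hq0 : (0 : ℝ) ≤ q := q.2.1
  have hP : P₁.card + P₂.card ≤ Q.card := by
    have h1 : P₁.card = (P₁.image fun e => ((Sum.inl e.1, Sum.inr e.2) :
        (Fin n₁ ⊕ Fin n₂) × (Fin n₁ ⊕ Fin n₂))).card :=
      (Finset.card_image_of_injective _ fun e e' h => by
        simp only [Prod.mk.injEq, Sum.inl.injEq, Sum.inr.injEq] at h
        exact Prod.ext h.1 h.2).symm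
    have h2 : P₂.card = (P₂.image fun e => ((Sum.inr e.2, Sum.inl e.1) :
        (Fin n₁ ⊕ Fin n₂) × (Fin n₁ ⊕ Fin n₂))).card :=
      (Finset.card_image_of_injective _ fun e e' h => by
        simp only [Prod.mk.injEq, Sum.inl.injEq, Sum.inr.injEq] at h
        exact Prod.ext h.2 h.1).symm
    rw [h1, h2, ← Finset.card_union_of_disjoint]
    · refine Finset.card_le_card (Finset.union_subset ?_ ?_)
      · intro p hp
        obtain ⟨e, he, rfl⟩ := Finset.mem_image.1 hp
        exact (Finset.mem_filter.1 he).2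
      · intro p hp
        obtain ⟨e, he, rfl⟩ := Finset.mem_image.1 hp
        exact (Finset.mem_filter.1 he).2
    · rw [Finset.disjoint_left]
      intro p hp hp'
      obtain ⟨e, he, rfl⟩ := Finset.mem_image.1 hp
      obtain ⟨e', he', h⟩ := Finset.mem_image.1 hp'
      simp at h
  have hP' : (P₁.card : ℝ) + P₂.card ≤ N := le_trans (by exact_mod_cast hP) hN
  have hX : ∀ E : Set (Fin n₁ × Fin n₂),
      ((Q.filter fun p => (bipartiteGraph E).Adj p.1 p.2).card : ℝ) =
        ∑ a ∈ P₁, E.indicator (1 : Fin n₁ × Fin n₂ → ℝ) a +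
          ∑ a ∈ P₂, E.indicator (1 : Fin n₁ × Fin n₂ → ℝ) a := by
    intro E
    have h := sum_adj_bipartiteGraph E (fun p => if p ∈ Q then 1 else 0)
    simp only [mul_add, Finset.sum_add_distrib, mul_ite, mul_one, mul_zero] at h
    rw [Finset.sum_filter, Finset.sum_filter]
    refine Eq.trans ?_ h
    rw [← Finset.sum_filter, ← Finset.sum_filter, Finset.sum_const, nsmul_eq_mul, mul_one]
    congr 2
    ext p
    simp [and_comm]
  refine ⟨(P₁.card + P₂.card) * q, mul_le_mul_of_nonneg_right hP' hq0, ?_⟩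
  calc _ ≤ ∫ E : Set (Fin n₁ × Fin n₂),
        (2 * (∑ a ∈ P₁, E.indicator (1 : Fin n₁ × Fin n₂ → ℝ) a - P₁.card * q) ^ 2 +
          2 * (∑ a ∈ P₂, E.indicator (1 : Fin n₁ × Fin n₂ → ℝ) a - P₂.card * q) ^ 2)
          ∂(setBernoulli Set.univ q) := by
        refine integral_mono Integrable.of_finite Integrable.of_finite fun E => ?_
        simp only [hX]
        nlinarith [sq_nonneg ((∑ a ∈ P₁, E.indicator (1 : Fin n₁ × Fin n₂ → ℝ) a - P₁.card * q) -
          (∑ a ∈ P₂, E.indicator (1 : Fin n₁ × Fin n₂ → ℝ) a - P₂.card * q))]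
    _ ≤ 2 * ((P₁.card : ℝ) * q) + 2 * ((P₂.card : ℝ) * q) := by
        rw [integral_add Integrable.of_finite Integrable.of_finite, integral_const_mul,
          integral_const_mul]
        have h1 := integral_sub_sq_le q P₁
        have h2 := integral_sub_sq_le q P₂
        linarith
    _ ≤ 2 * (N * q) := by
        have := mul_le_mul_of_nonneg_right hP' hq0
        linarith

open scoped Classical in
/-- The expected maximum of the numbers of adjacent pairs in the members of a family. -/
theorem integral_sup_card_adj_le (q : unitInterval) {κ : Type*} (S : Finset κ)
    (Q : κ → Finset ((Fin n₁ ⊕ Fin n₂) × (Fin n₁ ⊕ Fin n₂))) {N δ : ℝ} (hδ : 0 < δ) (hN0 : 0 ≤ N)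
    (hN : ∀ k ∈ S, ((Q k).card : ℝ) ≤ N) (hNδ : N * q ≤ δ ^ 2) :
    ∫ E : Set (Fin n₁ × Fin n₂),
      ((S.sup fun k => ((Q k).filter fun p => (bipartiteGraph E).Adj p.1 p.2).card : ℕ) : ℝ)
        ∂(setBernoulli Set.univ q) ≤ N * q + 3 * S.card * δ := by
  have hq0 : (0 : ℝ) ≤ q := q.2.1
  have hμ : ∀ k, ∃ μ : ℝ, k ∈ S → μ ≤ N * q ∧ ∫ E : Set (Fin n₁ × Fin n₂),
      ((((Q k).filter fun p => (bipartiteGraph E).Adj p.1 p.2).card : ℝ) - μ) ^ 2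
        ∂(setBernoulli Set.univ q) ≤ 2 * (N * q) := by
    intro k
    by_cases hk : k ∈ S
    · obtain ⟨μ, h⟩ := exists_mean_integral_sub_sq_le q (Q k) (hN k hk)
      exact ⟨μ, fun _ => h⟩
    · exact ⟨0, fun h => (hk h).elim⟩
  choose μ hμ using hμ
  set X : κ → Set (Fin n₁ × Fin n₂) → ℕ :=
    fun k E => ((Q k).filter fun p => (bipartiteGraph E).Adj p.1 p.2).card with hX
  have hpt : ∀ E, ((S.sup fun k => X k E : ℕ) : ℝ) ≤
      N * q + ∑ k ∈ S, (((X k E : ℝ) - μ k) ^ 2 / δ + δ) := by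
    intro E
    have hnn : ∀ k ∈ S, 0 ≤ ((X k E : ℝ) - μ k) ^ 2 / δ + δ := fun k _ => by positivity
    rcases S.eq_empty_or_nonempty with rfl | hS
    · simpa using mul_nonneg hN0 hq0
    · obtain ⟨k, hk, hsup⟩ := Finset.exists_mem_eq_sup S hS fun k => X k E
      rw [hsup]
      have h1 := Finset.single_le_sum hnn hk
      have h2 := (hμ k hk).1
      -- By AM-GM a deviation is bounded by its square over `δ` plus `δ`. The right side is
      -- nonnegative, so the maximum over `k` may be replaced by a sum.
      have h3 : (X k E : ℝ) - μ k ≤ ((X k E : ℝ) - μ k) ^ 2 / δ + δ := by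
        rw [div_add' _ _ _ hδ.ne', le_div_iff₀ hδ]
        nlinarith [sq_nonneg ((X k E : ℝ) - μ k - δ), sq_nonneg ((X k E : ℝ) - μ k)]
      linarith
  calc _ ≤ ∫ E : Set (Fin n₁ × Fin n₂), (N * q + ∑ k ∈ S, (((X k E : ℝ) - μ k) ^ 2 / δ + δ))
        ∂(setBernoulli Set.univ q) :=
        integral_mono Integrable.of_finite Integrable.of_finite hpt
    _ ≤ N * q + ∑ k ∈ S, 3 * δ := by
        rw [integral_add Integrable.of_finite Integrable.of_finite, integral_const,
          integral_finsetSum _ fun _ _ => Integrable.of_finite]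
        simp only [probReal_univ, one_smul]
        gcongr with k hk
        rw [integral_add Integrable.of_finite Integrable.of_finite, integral_div, integral_const]
        simp only [probReal_univ, one_smul]
        have h1 := (hμ k hk).2
        have h2 : 2 * (N * q) / δ ≤ 2 * δ := by
          rw [div_le_iff₀ hδ]; nlinarith
        have h3 := div_le_div_of_nonneg_right h1 hδ.le
        linarith
    _ = N * q + 3 * S.card * δ := by
        rw [Finset.sum_const, nsmul_eq_mul]; ring

end Concentration

/-! ### The allocation with two halves of machines. -/

section Design

variable {V : Type*} [Fintype V] {K r h t u : ℕ}

open scoped Classical in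
/-- A balanced reducer assignment together with small covering map sets extends to an
allocation. -/
theorem exists_allocation_of_cover (hK : 0 < K) (hrK : r ≤ K) (hdvd : K ∣ Fintype.card V)
    (ρ : V → Fin K)
    (hρ : ∀ k, K * (Finset.univ.filter fun v => ρ v = k).card = Fintype.card V)
    (B : Fin K → Finset V) (hcover : ∀ v, ∃ k, v ∈ B k)
    (hB : ∀ k, K * (B k).card ≤ r * Fintype.card V) :
    ∃ A : Allocation V K r, (∀ v, A.reducer v = ρ v) ∧ ∀ k, B k ⊆ A.M k := by
  obtain ⟨s, hs⟩ := hdvd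
  -- Map sets are padded to the exact size; there is room since `r ≤ K`, and additional local values
  -- do no harm.
  have hM : ∀ k, ∃ M : Finset V, B k ⊆ M ∧ M.card = r * s := by
    intro k
    refine Finset.exists_superset_card_eq ?_ ?_
    · have := hB k
      rw [hs] at this
      rw [mul_left_comm] at this
      exact Nat.le_of_mul_le_mul_left this hK
    · rw [hs]
      exact Nat.mul_le_mul_right s hrK
  choose M hBM hMc using hM
  let A : Allocation V K r :=
    { M := M
      R := fun k => Finset.univ.filter fun v => ρ v = k
      map_cover := fun v => (hcover v).imp fun k hk => hBM k hk
      map_card := fun k => by rw [hMc, hs]; ring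
      reduce_cover := fun v => ⟨ρ v, by simp⟩
      reduce_disjoint := fun k l hkl => by
        rw [Finset.disjoint_left]
        intro v hv hv'
        exact hkl ((Finset.mem_filter.1 hv).2.symm.trans (Finset.mem_filter.1 hv').2)
      reduce_card := hρ }
  refine ⟨A, fun v => A.mem_R_iff.1 ?_, hBM⟩
  simp [A]

theorem card_filter_fst_eq {α β : Type*} [DecidableEq α] [Fintype β] (φ : V ≃ α × β) (a : α) :
    (Finset.univ.filter fun v => (φ v).1 = a).card = Fintype.card β := by
  refine (Finset.card_bij (s := Finset.univ) (fun b _ => φ.symm (a, b)) (by simp) (by simp)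
    fun v hv => ⟨(φ v).2, Finset.mem_univ _, ?_⟩).symm
  rw [Equiv.symm_apply_eq, ← (Finset.mem_filter.1 hv).2]

/-- The lower bound for the infimum defining `optimalLoad` needs this, since a real infimum over an
empty type is `0`. Each machine maps at least what it reduces. -/
theorem nonempty_allocation (hr : 1 ≤ r) (hrK : r ≤ K) (hdvd : K ∣ Fintype.card V) :
    Nonempty (Allocation V K r) := by
  classical
  obtain ⟨s, hs⟩ := hdvd
  let φ : V ≃ Fin K × Fin s := Fintype.equivOfCardEq (by simp [hs])
  have hc : ∀ k, (Finset.univ.filter fun v => (φ v).1 = k).card = s := by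
    intro k
    simpa using card_filter_fst_eq φ k
  have hρ : ∀ k, K * (Finset.univ.filter fun v => (φ v).1 = k).card = Fintype.card V := by
    intro k; rw [hc, hs]
  obtain ⟨A, -⟩ := exists_allocation_of_cover (r := r) (by omega) hrK ⟨s, hs⟩ (fun v => (φ v).1) hρ
    (fun k => Finset.univ.filter fun v => (φ v).1 = k) (fun v => ⟨(φ v).1, by simp⟩)
    (fun k => by rw [hρ]; exact Nat.le_mul_of_pos_left _ hr)
  exact ⟨A⟩

/-- Positions of vertices: two halves of `h` machines; the vertices reduced by a machine fall into
`t` copies of the `r`-subsets of a half, which say who maps them, and `u` remaining ones. -/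
abbrev Cell (h r t u : ℕ) : Type :=
  (Bool × Fin h) × (({P : Finset (Fin h) // P.card = r} × Fin t) ⊕ Fin u)

theorem card_cell : Fintype.card (Cell h r t u) = 2 * h * (h.choose r * t + u) := by
  simp [Cell, Fintype.card_finset_len]

/-- The machine `k` is designated to map the vertex at position `v`. -/
def MapsCell (k : Bool × Fin h) (v : Cell h r t u) : Prop :=
  (∃ P τ, v.2 = Sum.inl (P, τ) ∧ v.1.1 = !k.1 ∧ k.2 ∈ P.1) ∨ (v.1 = k ∧ ∃ y, v.2 = Sum.inr y)

open scoped Classical in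
-- A machine lies in `(h - 1).choose (r - 1)` of the batches, each occurring `t` times at each of
-- the `h` machines of the other half, and `h * (h - 1).choose (r - 1) = r * h.choose r`. Its own
-- `u` leftovers fit because `1 ≤ r`.
theorem card_mapsCell_le (hr : 1 ≤ r) (hrh : r ≤ h) (k : Bool × Fin h) :
    (Finset.univ.filter fun v : Cell h r t u => MapsCell k v).card ≤
      r * (h.choose r * t + u) := by
  let F : Finset {P : Finset (Fin h) // P.card = r} := Finset.univ.filter fun P => k.2 ∈ P.1
  have hF : F.card ≤ (h - 1).choose (r - 1) := by
    have h1 := Finset.card_filter_powersetCard_subset ({k.2} : Finset (Fin h)) Finset.univ r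
      (Finset.subset_univ _) (by simpa using hr)
    simp only [Finset.card_univ, Fintype.card_fin, Finset.card_singleton] at h1
    rw [← h1]
    refine Finset.card_le_card_of_injOn Subtype.val ?_ Subtype.val_injective.injOn
    intro P hP
    simp only [F, Finset.coe_filter, Finset.mem_univ, true_and, Set.mem_ofPred_eq] at hP
    simp [P.2, hP]
  have hsub : (Finset.univ.filter fun v : Cell h r t u => MapsCell k v) ⊆
      ((Finset.univ : Finset (Fin h)) ×ˢ (F ×ˢ (Finset.univ : Finset (Fin t)))).image
        (fun x => (((!k.1, x.1), Sum.inl x.2) : Cell h r t u)) ∪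
      (Finset.univ : Finset (Fin u)).image (fun y => ((k, Sum.inr y) : Cell h r t u)) := by
    rintro ⟨⟨a, m⟩, z⟩ hv
    rcases (Finset.mem_filter.1 hv).2 with ⟨P, τ, hz, ha, hP⟩ | ⟨ha, y, hz⟩
    · refine Finset.mem_union_left _ (Finset.mem_image.2 ⟨(m, (P, τ)), ?_, ?_⟩)
      · simpa [F] using hP
      · simp only at hz ha
        rw [hz, ha]
    · refine Finset.mem_union_right _ (Finset.mem_image.2 ⟨y, Finset.mem_univ _, ?_⟩)
      simp only at hz ha
      rw [hz, ha]
  refine (Finset.card_le_card hsub).trans ((Finset.card_union_le _ _).trans ?_)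
  have h1 := Finset.card_image_le (s := (Finset.univ : Finset (Fin h)) ×ˢ
    (F ×ˢ (Finset.univ : Finset (Fin t))))
    (f := fun x => (((!k.1, x.1), Sum.inl x.2) : Cell h r t u))
  have h2 := Finset.card_image_le (s := (Finset.univ : Finset (Fin u)))
    (f := fun y => ((k, Sum.inr y) : Cell h r t u))
  simp only [Finset.card_product, Finset.card_univ, Fintype.card_fin] at h1 h2
  obtain ⟨h', rfl⟩ : ∃ h', h = h' + 1 := ⟨h - 1, by omega⟩
  obtain ⟨r', rfl⟩ : ∃ r', r = r' + 1 := ⟨r - 1, by omega⟩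
  have h3 := Nat.add_one_mul_choose_eq h' r'
  simp only [Nat.add_sub_cancel] at hF
  calc _ ≤ (h' + 1) * (F.card * t) + u := add_le_add h1 h2
    _ ≤ (h' + 1) * (h'.choose r' * t) + u := by gcongr
    _ = (r' + 1) * ((h' + 1).choose (r' + 1) * t) + u := by
        rw [← mul_assoc, h3]; ring
    _ ≤ (r' + 1) * ((h' + 1).choose (r' + 1) * t) + (r' + 1) * u := by
        gcongr
        exact Nat.le_mul_of_pos_left _ (by omega)
    _ = _ := by ring

theorem exists_design (hr : 1 ≤ r) (hrh : r ≤ h) (eK : Fin K ≃ Bool × Fin h)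
    (φ : V ≃ Cell h r t u) :
    ∃ A : Allocation V K r, (∀ v, eK (A.reducer v) = (φ v).1) ∧
      ∀ k v, MapsCell (eK k) (φ v) → v ∈ A.M k := by
  classical
  have hK : K = 2 * h := by simpa using Fintype.card_congr eK
  have hV : Fintype.card V = 2 * h * (h.choose r * t + u) := by
    rw [Fintype.card_congr φ, card_cell]
  have hc : ∀ k, (Finset.univ.filter fun v => eK.symm (φ v).1 = k).card = h.choose r * t + u := by
    intro k
    simp only [Equiv.symm_apply_eq]
    rw [card_filter_fst_eq φ (eK k)]
    simp [Fintype.card_finset_len]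
  have hcover : ∀ v, ∃ k, v ∈ Finset.univ.filter fun v => MapsCell (eK k) (φ v) := by
    intro v
    rcases hv : (φ v).2 with ⟨P, τ⟩ | y
    · have hP : P.1.Nonempty := by
        rw [← Finset.card_pos, P.2]; exact hr
      obtain ⟨l, hl⟩ := hP
      refine ⟨eK.symm (!(φ v).1.1, l), ?_⟩
      simp only [Finset.mem_filter, Finset.mem_univ, true_and, Equiv.apply_symm_apply]
      exact Or.inl ⟨P, τ, hv, by simp, hl⟩
    · refine ⟨eK.symm (φ v).1, ?_⟩
      simp only [Finset.mem_filter, Finset.mem_univ, true_and, Equiv.apply_symm_apply]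
      exact Or.inr ⟨rfl, y, hv⟩
  have hB : ∀ k, K * (Finset.univ.filter fun v => MapsCell (eK k) (φ v)).card ≤
      r * Fintype.card V := by
    intro k
    have h1 : (Finset.univ.filter fun v => MapsCell (eK k) (φ v)).card =
        (Finset.univ.filter fun v : Cell h r t u => MapsCell (eK k) v).card := by
      refine Finset.card_bij (fun v _ => φ v) (by simp) (by simp) fun w hw => ⟨φ.symm w, ?_, by simp⟩
      simpa using hw
    rw [h1, hV]
    calc _ ≤ K * (r * (h.choose r * t + u)) :=
          Nat.mul_le_mul_left _ (card_mapsCell_le hr hrh _)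
      _ = _ := by rw [hK]; ring
  obtain ⟨A, hA, hM⟩ := exists_allocation_of_cover (r := r) (by omega) (by omega)
    ⟨_, by rw [hV, hK]⟩ (fun v => eK.symm (φ v).1) (fun k => by rw [hc, hV, hK]) _ hcover hB
  refine ⟨A, fun v => ?_, fun k v hv => hM k (by simpa using hv)⟩
  rw [hA, Equiv.apply_symm_apply]

/-- The machines of the half `a`. -/
def halfEmbedding (eK : Fin K ≃ Bool × Fin h) (a : Bool) : Fin h ↪ Fin K :=
  (Function.Embedding.sectR a (Fin h)).trans eK.symm.toEmbedding

theorem halfEmbedding_apply (eK : Fin K ≃ Bool × Fin h) (a : Bool) (l : Fin h) :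
    halfEmbedding eK a l = eK.symm (a, l) := rfl

/-- The machines that map the vertex at a given position in the coded part of the design. -/
def cellBatch (eK : Fin K ≃ Bool × Fin h) (v : Cell h r t u) : Finset (Fin K) :=
  match v.2 with
  | Sum.inl x => x.1.1.map (halfEmbedding eK !v.1.1)
  | Sum.inr _ => ∅

/-- Values that are served by coded multicasting. -/
def GoodCell (v w : Cell h r t u) : Prop := v.1.1 = !w.1.1 ∧ w.2.isLeft = true

/-- The groups of `r + 1` machines within one half. -/
def machineGroups (r : ℕ) (eK : Fin K ≃ Bool × Fin h) : Finset (Finset (Fin K)) :=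
  ((Finset.univ : Finset Bool) ×ˢ (Finset.univ : Finset (Fin h)).powersetCard (r + 1)).image
    fun x => x.2.map (halfEmbedding eK x.1)

theorem card_machineGroups_le (eK : Fin K ≃ Bool × Fin h) :
    (machineGroups r eK).card ≤ 2 * h.choose (r + 1) := by
  refine Finset.card_image_le.trans ?_
  simp

theorem card_of_mem_machineGroups (eK : Fin K ≃ Bool × Fin h) {S : Finset (Fin K)}
    (hS : S ∈ machineGroups r eK) : S.card = r + 1 := by
  obtain ⟨x, hx, rfl⟩ := Finset.mem_image.1 hS
  rw [Finset.card_map]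
  exact (Finset.mem_powersetCard.1 (Finset.mem_product.1 hx).2).2

theorem mapsCell_of_mem_cellBatch (eK : Fin K ≃ Bool × Fin h) {v : Cell h r t u} {k : Fin K}
    (hk : k ∈ cellBatch eK v) : MapsCell (eK k) v := by
  rcases hv : v.2 with ⟨P, τ⟩ | y
  · rw [cellBatch, hv] at hk
    obtain ⟨l, hl, rfl⟩ := Finset.mem_map.1 hk
    exact Or.inl ⟨P, τ, hv, by simp [halfEmbedding_apply], by simpa [halfEmbedding_apply] using hl⟩
  · rw [cellBatch, hv] at hk
    simp at hk

theorem insert_cellBatch_mem (eK : Fin K ≃ Bool × Fin h) {v w : Cell h r t u} {k : Fin K}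
    (hk : eK k = v.1) (hg : GoodCell v w) (hn : k ∉ cellBatch eK w) :
    insert k (cellBatch eK w) ∈ machineGroups r eK := by
  obtain ⟨⟨P, τ⟩, hw⟩ := Sum.isLeft_iff.1 hg.2
  have hk' : k = eK.symm (!w.1.1, v.1.2) := by
    rw [Equiv.eq_symm_apply, hk, ← hg.1]
  rw [cellBatch, hw] at hn ⊢
  simp only at hn ⊢
  have hl : v.1.2 ∉ P.1 := by
    intro hl
    exact hn (Finset.mem_map.2 ⟨v.1.2, hl, hk'.symm⟩)
  refine Finset.mem_image.2 ⟨(!w.1.1, insert v.1.2 P.1), ?_, ?_⟩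
  · simp [Finset.mem_powersetCard, Finset.card_insert_of_notMem hl, P.2]
  · simp only [Finset.map_insert, halfEmbedding_apply]
    rw [← hk']

/-- Given `S` and `k`, the batch of the second vertex is `S.erase k` and its half is opposite to
that of `k`. Free are only the place of the first vertex among those reduced by `k`, and the reducer
and copy of the second. -/
theorem card_codedPairs_le (eK : Fin K ≃ Bool × Fin h) (φ : V ≃ Cell h r t u)
    (A : Allocation V K r) (hA : ∀ v, eK (A.reducer v) = (φ v).1) (S : Finset (Fin K))
    (k : Fin K) :
    (codedPairs A (fun v => cellBatch eK (φ v)) (fun v w => GoodCell (φ v) (φ w)) S k).card ≤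
      (h.choose r * t + u) * (h * t) := by
  classical
  set Q := codedPairs A (fun v => cellBatch eK (φ v)) (fun v w => GoodCell (φ v) (φ w)) S k
  by_cases ht : t = 0
  · have : Q = ∅ := by
      rw [Finset.eq_empty_iff_forall_notMem]
      intro p hp
      have hg := (Finset.mem_filter.1 hp).2.1
      obtain ⟨⟨P, τ⟩, -⟩ := Sum.isLeft_iff.1 hg.2
      subst ht
      exact τ.elim0
    simp [this]
  -- A dummy copy for leftover vertices, which never occur as second vertex of a good pair.
  let τ₀ : Fin t := ⟨0, by omega⟩
  let f : V × V → (({P : Finset (Fin h) // P.card = r} × Fin t) ⊕ Fin u) × (Fin h × Fin t) :=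
    fun p => ((φ p.1).2, ((φ p.2).1.2, (φ p.2).2.elim (fun x => x.2) (fun _ => τ₀)))
  have hinj : Set.InjOn f Q := by
    intro p hp p' hp' hf
    obtain ⟨hg, hred, hn, hS⟩ := (Finset.mem_filter.1 hp).2
    obtain ⟨hg', hred', hn', hS'⟩ := (Finset.mem_filter.1 hp').2
    simp only [f, Prod.mk.injEq] at hf
    obtain ⟨h1, h2, h3⟩ := hf
    have hfst : (φ p.1).1 = (φ p'.1).1 := by rw [← hA, ← hA, hred, hred']
    have e1 : p.1 = p'.1 := φ.injective (Prod.ext hfst h1)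
    have hhalf : (φ p.2).1.1 = (φ p'.2).1.1 := by
      have a := hg.1
      have a' := hg'.1
      rw [hfst, a'] at a
      simpa using a.symm
    have hbatch : cellBatch eK (φ p.2) = cellBatch eK (φ p'.2) := by
      have := congrArg (fun X => X.erase k) (hS.trans hS'.symm)
      simpa [Finset.erase_insert hn, Finset.erase_insert hn'] using this
    obtain ⟨⟨P, τ⟩, hw⟩ := Sum.isLeft_iff.1 hg.2
    obtain ⟨⟨P', τ'⟩, hw'⟩ := Sum.isLeft_iff.1 hg'.2
    rw [hw, hw'] at h3
    simp only [cellBatch] at hbatch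
    rw [hw, hw'] at hbatch
    simp only [hhalf] at hbatch
    have hP : P = P' := Subtype.ext (Finset.map_injective _ hbatch)
    have e2 : p.2 = p'.2 := by
      refine φ.injective (Prod.ext (Prod.ext hhalf h2) ?_)
      rw [hw, hw', hP]
      simp only [Sum.elim_inl] at h3
      rw [h3]
    exact Prod.ext e1 e2
  have := Finset.card_le_card_of_injOn (t := Finset.univ) f (by simp) hinj
  simpa [Fintype.card_finset_len] using this

end Design

/-! ### Expected load of the coded scheme. -/

section Achievability

variable {n₁ n₂ : ℕ}

/-- The vertices can be split into two equal halves such that few pairs from different clusters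
lie in the same half. -/
theorem exists_equiv_few_same_half {N : ℕ} {Z : Type*} [Fintype Z] (hZ : Fintype.card Z = N)
    (hn : n₁ + n₂ = N + N) :
    ∃ φ : Fin n₁ ⊕ Fin n₂ ≃ Bool × Z,
      2 * ((Finset.univ.filter fun e : Fin n₁ × Fin n₂ =>
        (φ (Sum.inl e.1)).1 = (φ (Sum.inr e.2)).1).card : ℝ) ≤
          ((n₁ + n₂ : ℕ) : ℝ) * |(n₁ : ℝ) - n₂| := by
  -- The clusters are listed one after the other and the list is cut in the middle. Only `|n₁ - n₂|
  -- / 2` vertices, all of the larger cluster, then fall into the wrong half.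
  let eZ : Fin N ≃ Z := (Fintype.equivFinOfCardEq hZ).symm
  let φ : Fin n₁ ⊕ Fin n₂ ≃ Bool × Z :=
    (finSumFinEquiv.trans ((finCongr hn).trans (finSumFinEquiv.symm.trans
      (Equiv.boolProdEquivSum (Fin N)).symm))).trans ((Equiv.refl Bool).prodCongr eZ)
  have hφ : ∀ v, (φ v).1 = decide (N ≤ (finSumFinEquiv v).val) := by
    intro v
    have key : ∀ x : Fin (N + N),
        ((Equiv.boolProdEquivSum (Fin N)).symm (finSumFinEquiv.symm x)).1 =
          decide (N ≤ x.val) := by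
      intro x
      obtain ⟨y, rfl⟩ := finSumFinEquiv.surjective x
      rw [Equiv.symm_apply_apply]
      rcases y with y | y
      · simp [Nat.not_le.2 y.2]
      · simp
    exact key (finCongr hn (finSumFinEquiv v))
  refine ⟨φ, ?_⟩
  have hset : (Finset.univ.filter fun e : Fin n₁ × Fin n₂ =>
        (φ (Sum.inl e.1)).1 = (φ (Sum.inr e.2)).1) =
      Finset.univ.filter fun e : Fin n₁ × Fin n₂ => (N ≤ e.1.val ↔ N ≤ n₁ + e.2.val) := by
    ext e
    simp only [hφ, decide_eq_decide, Finset.mem_filter, Finset.mem_univ, true_and]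
    simp
  rw [hset]
  have hn' : (n₁ : ℝ) + n₂ = 2 * N := by
    have : n₁ + n₂ = 2 * N := by omega
    exact_mod_cast this
  push_cast
  have h1 : (0 : ℝ) ≤ n₁ := Nat.cast_nonneg _
  have h2 : (0 : ℝ) ≤ n₂ := Nat.cast_nonneg _
  rcases le_total n₁ N with hle | hle
  · have hcard : (Finset.univ.filter fun e : Fin n₁ × Fin n₂ =>
        (N ≤ e.1.val ↔ N ≤ n₁ + e.2.val)).card ≤ n₁ * (N - n₁) := by
      have := Finset.card_le_card_of_injOn (s := Finset.univ.filter fun e : Fin n₁ × Fin n₂ =>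
        (N ≤ e.1.val ↔ N ≤ n₁ + e.2.val)) (t := Finset.univ ×ˢ Finset.range (N - n₁))
        (fun e => (e.1, e.2.val)) ?_ ?_
      · simpa using this
      · intro e he
        have := (Finset.mem_filter.1 he).2
        have := e.1.2
        simp only [Finset.coe_product, Set.mem_prod, Finset.coe_univ, Set.mem_univ, true_and,
          Finset.coe_range, Set.mem_Iio]
        omega
      · intro e _ e' _ h
        simp only [Prod.mk.injEq] at h
        exact Prod.ext h.1 (Fin.ext h.2)
    have hcard' : ((Finset.univ.filter fun e : Fin n₁ × Fin n₂ =>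
        (N ≤ e.1.val ↔ N ≤ n₁ + e.2.val)).card : ℝ) ≤ n₁ * (N - n₁) := by
      have h := (Nat.cast_le (α := ℝ)).2 hcard
      rwa [Nat.cast_mul, Nat.cast_sub hle] at h
    have hle' : (n₁ : ℝ) ≤ N := by exact_mod_cast hle
    have h3 := neg_abs_le ((n₁ : ℝ) - n₂)
    nlinarith [abs_nonneg ((n₁ : ℝ) - n₂)]
  · have hcard : (Finset.univ.filter fun e : Fin n₁ × Fin n₂ =>
        (N ≤ e.1.val ↔ N ≤ n₁ + e.2.val)).card ≤ (n₁ - N) * n₂ := by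
      have := Finset.card_le_card_of_injOn (s := Finset.univ.filter fun e : Fin n₁ × Fin n₂ =>
        (N ≤ e.1.val ↔ N ≤ n₁ + e.2.val)) (t := Finset.Ico N n₁ ×ˢ Finset.univ)
        (fun e => (e.1.val, e.2)) ?_ ?_
      · simpa using this
      · intro e he
        have := (Finset.mem_filter.1 he).2
        have := e.1.2
        simp only [Finset.coe_product, Set.mem_prod, Finset.coe_univ, Set.mem_univ, and_true,
          Finset.coe_Ico, Set.mem_Ico]
        omega
      · intro e _ e' _ h
        simp only [Prod.mk.injEq] at h
        exact Prod.ext (Fin.ext h.1) h.2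
    have hcard' : ((Finset.univ.filter fun e : Fin n₁ × Fin n₂ =>
        (N ≤ e.1.val ↔ N ≤ n₁ + e.2.val)).card : ℝ) ≤ (n₁ - N) * n₂ := by
      have h := (Nat.cast_le (α := ℝ)).2 hcard
      rwa [Nat.cast_mul, Nat.cast_sub hle] at h
    have hle' : (N : ℝ) ≤ n₁ := by exact_mod_cast hle
    have h3 := le_abs_self ((n₁ : ℝ) - n₂)
    nlinarith [abs_nonneg ((n₁ : ℝ) - n₂)]

variable {h r t u : ℕ}

open scoped Classical in
-- A pair fails to be good because both vertices share a half, which is rare by the choice of `φ`,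
-- or because the second is one of the `2 * h * u` leftovers.
theorem sum_not_goodCell_le (φ : Fin n₁ ⊕ Fin n₂ ≃ Cell h r t u)
    {D : ℝ} (hD : 2 * ((Finset.univ.filter fun e : Fin n₁ × Fin n₂ =>
        (φ (Sum.inl e.1)).1.1 = (φ (Sum.inr e.2)).1.1).card : ℝ) ≤ ((n₁ + n₂ : ℕ) : ℝ) * D) :
    ∑ e : Fin n₁ × Fin n₂,
      ((if ¬ GoodCell (φ (Sum.inl e.1)) (φ (Sum.inr e.2)) then (1 : ℝ) else 0) +
        (if ¬ GoodCell (φ (Sum.inr e.2)) (φ (Sum.inl e.1)) then 1 else 0)) ≤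
      ((n₁ + n₂ : ℕ) : ℝ) * D + ((n₁ + n₂ : ℕ) : ℝ) * (2 * h * u) := by
  let L : Fin n₁ ⊕ Fin n₂ → ℝ := fun v => if (φ v).2.isLeft then 0 else 1
  let H : Fin n₁ × Fin n₂ → ℝ := fun e =>
    if (φ (Sum.inl e.1)).1.1 = (φ (Sum.inr e.2)).1.1 then 1 else 0
  have hL0 : ∀ v, 0 ≤ L v := fun v => by simp only [L]; split_ifs <;> norm_num
  have hL : ∑ v, L v = 2 * h * u := by
    have e1 : ∑ v, L v = ∑ x : Cell h r t u, if x.2.isLeft then (0 : ℝ) else 1 :=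
      Equiv.sum_comp φ fun x => if x.2.isLeft then (0 : ℝ) else 1
    rw [e1, Fintype.sum_prod_type]
    simp
  have hbad : ∀ v w, (if ¬ GoodCell (φ v) (φ w) then (1 : ℝ) else 0) ≤
      (if (φ v).1.1 = (φ w).1.1 then 1 else 0) + L w := by
    intro v w
    have h0 := hL0 w
    by_cases hg : GoodCell (φ v) (φ w)
    · rw [if_neg (not_not.2 hg)]
      split_ifs <;> linarith
    · rw [if_pos hg]
      by_cases hh : (φ v).1.1 = (φ w).1.1
      · rw [if_pos hh]; linarith
      · have hl : ¬ (φ w).2.isLeft = true := fun hl => hg ⟨Bool.eq_not.2 hh, hl⟩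
        have : L w = 1 := if_neg hl
        rw [if_neg hh, this, zero_add]
  have hpt : ∀ e : Fin n₁ × Fin n₂,
      ((if ¬ GoodCell (φ (Sum.inl e.1)) (φ (Sum.inr e.2)) then (1 : ℝ) else 0) +
        (if ¬ GoodCell (φ (Sum.inr e.2)) (φ (Sum.inl e.1)) then 1 else 0)) ≤
      2 * H e + (L (Sum.inr e.2) + L (Sum.inl e.1)) := by
    intro e
    have h1 := hbad (Sum.inl e.1) (Sum.inr e.2)
    have h2 := hbad (Sum.inr e.2) (Sum.inl e.1)
    simp only [eq_comm (a := (φ (Sum.inr e.2)).1.1)] at h2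
    simp only [H]
    linarith
  refine (Finset.sum_le_sum fun e _ => hpt e).trans ?_
  rw [Finset.sum_add_distrib, ← Finset.mul_sum]
  refine add_le_add ?_ ?_
  · refine le_trans (le_of_eq ?_) hD
    congr 1
    simp [H]
  · rw [← hL, Fintype.sum_sum_type, Finset.sum_add_distrib, Fintype.sum_prod_type,
      Fintype.sum_prod_type_right]
    simp only [Finset.sum_const, Finset.card_univ, Fintype.card_fin, nsmul_eq_mul]
    have h1 : 0 ≤ ∑ i, L (Sum.inl i : Fin n₁ ⊕ Fin n₂) := Finset.sum_nonneg fun _ _ => hL0 _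
    have h2 : 0 ≤ ∑ i, L (Sum.inr i : Fin n₁ ⊕ Fin n₂) := Finset.sum_nonneg fun _ _ => hL0 _
    push_cast
    nlinarith [mul_nonneg (Nat.cast_nonneg (α := ℝ) n₁) h1,
      mul_nonneg (Nat.cast_nonneg (α := ℝ) n₂) h2]

set_option maxHeartbeats 1000000 in
/-- Expected load of the coded scheme. -/
theorem exists_integral_commLoad_le {K T : ℕ} (q : unitInterval) (hq : 0 < q) (hT : 0 < T)
    (hr : 1 ≤ r) (hrh : r ≤ h) (hK : K = 2 * h) {s : ℕ} (hs : 0 < s) (hn : n₁ + n₂ = K * s) :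
    ∃ A : Allocation (Fin n₁ ⊕ Fin n₂) K r,
      ∫ E : Set (Fin n₁ × Fin n₂), commLoad (bipartiteGraph E) A T ∂(setBernoulli Set.univ q) ≤
        (q : ℝ) * (1 / (2 * r) * (1 - 2 * r / K) + |(n₁ : ℝ) - n₂| / ((n₁ + n₂ : ℕ) : ℝ) +
          K * h.choose r / ((n₁ + n₂ : ℕ) : ℝ)) +
        (r + 1) * (2 * h.choose (r + 1)) * (3 * (r + 1) + 1) *
          (√q / ((n₁ + n₂ : ℕ) : ℝ) + 1 / ((n₁ + n₂ : ℕ) : ℝ) ^ 2) := by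
  classical
  -- Each machine reduces `s` vertices; division by the number `C` of batches leaves fewer than `C`
  -- uncoded ones per machine, negligible as `C` is fixed.
  set C := h.choose r with hC
  have hCpos : 0 < C := Nat.choose_pos hrh
  set t := s / C with ht
  set u := s % C with hu
  have hsu : C * t + u = s := Nat.div_add_mod s C
  have huC : u ≤ C := (Nat.mod_lt _ hCpos).le
  obtain ⟨φ₀, hφ₀⟩ := exists_equiv_few_same_half (n₁ := n₁) (n₂ := n₂)
    (N := h * s)
    (Z := Fin h × (({P : Finset (Fin h) // P.card = r} × Fin t) ⊕ Fin u))
    (by simp [Fintype.card_finset_len, ← hC, hsu]) (by rw [hn, hK]; ring)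
  let φ : Fin n₁ ⊕ Fin n₂ ≃ Cell h r t u := φ₀.trans (Equiv.prodAssoc _ _ _).symm
  let eK : Fin K ≃ Bool × Fin h := Fintype.equivOfCardEq (by simp [hK])
  obtain ⟨A, hA, hM⟩ := exists_design hr hrh eK φ
  refine ⟨A, ?_⟩
  set n : ℝ := ((n₁ + n₂ : ℕ) : ℝ) with hnd
  set D := |(n₁ : ℝ) - n₂| with hD
  have hbad := sum_not_goodCell_le φ (D := D) hφ₀
  rw [← hnd] at hbad
  have hnK : n = K * s := by rw [hnd, hn]; push_cast; ring
  have hr' : (1 : ℝ) ≤ r := by exact_mod_cast hr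
  have hrh' : (r : ℝ) ≤ h := by exact_mod_cast hrh
  have hK' : (K : ℝ) = 2 * h := by rw [hK]; push_cast; ring
  have hs' : (1 : ℝ) ≤ s := by exact_mod_cast hs
  have hn0 : 0 < n := by rw [hnK, hK']; nlinarith
  have hT' : (1 : ℝ) ≤ T := by exact_mod_cast hT
  have hq' : (0 : ℝ) < q := hq
  have hcard : ((Fintype.card (Fin n₁ ⊕ Fin n₂) : ℕ) : ℝ) = n := by simp [hnd]
  have hCt : (C : ℝ) * t ≤ s := by
    have : C * t ≤ s := by omega
    exact_mod_cast this
  have hC' : (1 : ℝ) ≤ C := by exact_mod_cast hCpos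
  have ht0 : (0 : ℝ) ≤ t := Nat.cast_nonneg _
  have hts : (t : ℝ) ≤ s := by nlinarith
  let batch : Fin n₁ ⊕ Fin n₂ → Finset (Fin K) := fun v => cellBatch eK (φ v)
  let Good : Fin n₁ ⊕ Fin n₂ → Fin n₁ ⊕ Fin n₂ → Prop := fun v w => GoodCell (φ v) (φ w)
  let 𝒮 := machineGroups r eK
  let Q : Finset (Fin K) → Fin K → Finset ((Fin n₁ ⊕ Fin n₂) × (Fin n₁ ⊕ Fin n₂)) :=
    fun S k => codedPairs A batch Good S k
  let X : Finset (Fin K) → Set (Fin n₁ × Fin n₂) → ℕ := fun S E =>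
    S.sup fun k => ((Q S k).filter fun p => (bipartiteGraph E).Adj p.1 p.2).card
  let f : (Fin n₁ ⊕ Fin n₂) × (Fin n₁ ⊕ Fin n₂) → ℝ := fun p => if ¬ Good p.1 p.2 then 1 else 0
  have hbits : ∀ E : Set (Fin n₁ × Fin n₂), commLoad (bipartiteGraph E) A T ≤
      (∑ p, (if (bipartiteGraph E).Adj p.1 p.2 then f p else 0) +
        (r + 1) * ∑ S ∈ 𝒮, ((X S E : ℝ) / r + 1)) / n ^ 2 := by
    intro E
    -- Each member gets enough slots for a share `1 / r` of the largest demand in its group. The `+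
    -- 1` covers rounding and is absorbed below into `T * (X / r + 1)` because `1 ≤ T`.
    have h0 := minBits_le_coded (bipartiteGraph E) A T batch Good 𝒮 (fun S => X S E * T / r + 1)
      (fun j l hl => hM l j (mapsCell_of_mem_cellBatch eK hl))
      (fun S hS => card_of_mem_machineGroups eK hS)
      (fun i j hg hnm => insert_cellBatch_mem eK (hA i) hg hnm)
      (fun S hS k hk => by
        have h1 : ((Q S k).filter fun p => (bipartiteGraph E).Adj p.1 p.2).card ≤ X S E :=
          Finset.le_sup (f := fun k =>
            ((Q S k).filter fun p => (bipartiteGraph E).Adj p.1 p.2).card) hk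
        have h2 := Nat.lt_mul_div_succ (X S E * T) (show 0 < r by omega)
        exact (Nat.mul_le_mul_right T h1).trans h2.le)
    have h1 : (minBits (bipartiteGraph E) A T : ℝ) ≤
        ((Finset.univ.filter fun p : (Fin n₁ ⊕ Fin n₂) × (Fin n₁ ⊕ Fin n₂) =>
          (bipartiteGraph E).Adj p.1 p.2 ∧ ¬ Good p.1 p.2).card : ℝ) * T +
          (r + 1) * ∑ S ∈ 𝒮, ((X S E * T / r + 1 : ℕ) : ℝ) := by exact_mod_cast h0
    have h2 : ((Finset.univ.filter fun p : (Fin n₁ ⊕ Fin n₂) × (Fin n₁ ⊕ Fin n₂) =>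
          (bipartiteGraph E).Adj p.1 p.2 ∧ ¬ Good p.1 p.2).card : ℝ) =
        ∑ p, (if (bipartiteGraph E).Adj p.1 p.2 then f p else 0) := by
      simp only [f]
      simp_rw [← ite_and]
      rw [← Finset.sum_filter, Finset.sum_const, nsmul_eq_mul, mul_one]
    have h3 : ∀ S ∈ 𝒮, ((X S E * T / r + 1 : ℕ) : ℝ) ≤ T * ((X S E : ℝ) / r + 1) := by
      intro S _
      have := Nat.cast_div_le (α := ℝ) (m := X S E * T) (n := r)
      push_cast at this ⊢
      calc _ ≤ (X S E : ℝ) * T / r + T := add_le_add this hT'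
        _ = _ := by ring
    rw [commLoad, hcard, div_le_div_iff₀ (by positivity) (by positivity)]
    have h4 : (minBits (bipartiteGraph E) A T : ℝ) ≤
        T * (∑ p, (if (bipartiteGraph E).Adj p.1 p.2 then f p else 0) +
        (r + 1) * ∑ S ∈ 𝒮, ((X S E : ℝ) / r + 1)) := by
      refine h1.trans ?_
      rw [h2, mul_add, mul_comm]
      refine add_le_add le_rfl ?_
      rw [mul_left_comm, Finset.mul_sum (a := (T : ℝ))]
      exact mul_le_mul_of_nonneg_left (Finset.sum_le_sum h3) (by positivity)
    calc _ ≤ (T * (∑ p, (if (bipartiteGraph E).Adj p.1 p.2 then f p else 0) +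
        (r + 1) * ∑ S ∈ 𝒮, ((X S E : ℝ) / r + 1))) * n ^ 2 :=
          mul_le_mul_of_nonneg_right h4 (by positivity)
      _ = _ := by ring
  set N : ℝ := s * (h * t) with hN
  have hN0 : 0 ≤ N := by positivity
  -- This is the order of the standard deviation of a count of `n ^ 2` possible edges.
  set δ : ℝ := n * √q with hδ
  have hδ0 : 0 < δ := mul_pos hn0 (Real.sqrt_pos.2 hq')
  have hNδ : N * q ≤ δ ^ 2 := by
    rw [hδ, mul_pow, Real.sq_sqrt hq'.le]
    refine mul_le_mul_of_nonneg_right ?_ hq'.le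
    rw [hN, hnK, hK']
    have : (h : ℝ) * t ≤ 2 * h * s := by nlinarith
    have h2 : (s : ℝ) ≤ 2 * h * s := by nlinarith
    rw [sq]
    exact mul_le_mul h2 this (by positivity) (by positivity)
  have hX : ∀ S ∈ 𝒮, ∫ E : Set (Fin n₁ × Fin n₂), ((X S E : ℝ) / r + 1)
      ∂(setBernoulli Set.univ q) ≤ N * q / r + (3 * (r + 1) * δ + 1) := by
    intro S hS
    have h1 := integral_sup_card_adj_le q S (Q S) hδ0 hN0 (fun k _ => by
      have := card_codedPairs_le eK φ A hA S k
      rw [← hC, hsu] at this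
      rw [hN]
      exact_mod_cast this) hNδ
    rw [card_of_mem_machineGroups eK hS] at h1
    rw [integral_add Integrable.of_finite Integrable.of_finite, integral_div, integral_const]
    simp only [probReal_univ, one_smul]
    have h2 : (N * q + 3 * ((r + 1 : ℕ) : ℝ) * δ) / r ≤ N * q / r + 3 * (r + 1) * δ := by
      rw [add_div]
      refine add_le_add le_rfl ?_
      push_cast
      exact div_le_self (by positivity) hr'
    have h3 := div_le_div_of_nonneg_right h1 (by positivity : (0 : ℝ) ≤ r)
    linarith
  have h𝒮 : (𝒮.card : ℝ) ≤ 2 * h.choose (r + 1) := by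
    exact_mod_cast card_machineGroups_le (r := r) eK
  have hmain : (r + 1) * (2 * (h.choose (r + 1) : ℝ)) * (N * q / r) ≤
      n ^ 2 * (q * (1 / (2 * r) * (1 - 2 * r / K))) := by
    -- This identity turns the number of groups into the factor `h - r`, that is, `h * (1 - 2 * r /
    -- K)`.
    have e1 : ((r : ℝ) + 1) * h.choose (r + 1) = C * (h - r) := by
      have := Nat.choose_succ_right_eq h r
      have h' := congrArg (Nat.cast (R := ℝ)) this
      push_cast [Nat.cast_sub hrh] at h'
      rw [mul_comm]
      exact h'
    have e2 : n ^ 2 * (q * (1 / (2 * r) * (1 - 2 * r / K))) =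
        (2 * (h - r) * (q / r)) * (s * (h * s)) := by
      rw [hnK, hK']
      have : (h : ℝ) ≠ 0 := by linarith
      field_simp
    have e3 : (r + 1) * (2 * (h.choose (r + 1) : ℝ)) * (N * q / r) =
        (2 * (h - r) * (q / r)) * (s * (h * (C * t))) := by
      calc _ = (((r : ℝ) + 1) * h.choose (r + 1)) * (2 * (N * q / r)) := by ring
        _ = _ := by rw [e1, hN]; ring
    rw [e2, e3]
    have : 0 ≤ (h : ℝ) - r := by linarith
    have : 0 ≤ 2 * ((h : ℝ) - r) * (q / r) := by positivity
    gcongr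
  calc _ ≤ ∫ E : Set (Fin n₁ × Fin n₂),
        (∑ p, (if (bipartiteGraph E).Adj p.1 p.2 then f p else 0) +
          (r + 1) * ∑ S ∈ 𝒮, ((X S E : ℝ) / r + 1)) / n ^ 2 ∂(setBernoulli Set.univ q) :=
        integral_mono Integrable.of_finite Integrable.of_finite hbits
    _ ≤ (q * (n * D + n * (K * C)) + (r + 1) * (2 * h.choose (r + 1)) *
          (N * q / r + (3 * (r + 1) * δ + 1))) / n ^ 2 := by
        rw [integral_div, integral_add Integrable.of_finite Integrable.of_finite,
          integral_sum_adj_bipartiteGraph, integral_const_mul,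
          integral_finsetSum _ fun _ _ => Integrable.of_finite]
        have h1 : ∑ S ∈ 𝒮, ∫ E : Set (Fin n₁ × Fin n₂), ((X S E : ℝ) / r + 1)
            ∂(setBernoulli Set.univ q) ≤
            2 * h.choose (r + 1) * (N * q / r + (3 * (r + 1) * δ + 1)) := by
          refine (Finset.sum_le_sum hX).trans ?_
          rw [Finset.sum_const, nsmul_eq_mul]
          exact mul_le_mul_of_nonneg_right h𝒮 (by positivity)
        have h2 : n * D + n * (2 * h * u) ≤ n * D + n * (K * C) := by
          rw [hK']
          have : (u : ℝ) ≤ C := by exact_mod_cast huC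
          gcongr
        have h3 := mul_le_mul_of_nonneg_left (hbad.trans h2) hq'.le
        have h4 := mul_le_mul_of_nonneg_left h1 (by positivity : (0 : ℝ) ≤ (r : ℝ) + 1)
        refine div_le_div_of_nonneg_right (add_le_add h3 (h4.trans (le_of_eq ?_))) (by positivity)
        ring
    _ ≤ (q * (n * D + n * (K * C)) + (n ^ 2 * (q * (1 / (2 * r) * (1 - 2 * r / K))) +
          (r + 1) * (2 * h.choose (r + 1)) * (3 * (r + 1) + 1) * (δ + 1))) / n ^ 2 := by
        refine div_le_div_of_nonneg_right (add_le_add le_rfl ?_) (by positivity)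
        rw [mul_add]
        refine add_le_add hmain ?_
        rw [mul_assoc _ (3 * ((r : ℝ) + 1) + 1)]
        refine mul_le_mul_of_nonneg_left ?_ (by positivity)
        nlinarith
    _ = _ := by
        rw [hδ]
        field_simp
        ring

end Achievability

/-! ### Bounds for the optimal load at finite size, and the limit. -/

section OptimalLoad

variable {n₁ n₂ K r T : ℕ}

theorem integral_commLoad_nonneg (q : unitInterval) (A : Allocation (Fin n₁ ⊕ Fin n₂) K r) :
    0 ≤ ∫ E : Set (Fin n₁ × Fin n₂), commLoad (bipartiteGraph E) A T
      ∂(setBernoulli Set.univ q) :=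
  integral_nonneg fun _ => by unfold commLoad; positivity

theorem optimalLoad_nonneg (q : unitInterval) : 0 ≤ optimalLoad n₁ n₂ K r T q :=
  Real.iInf_nonneg fun A => integral_commLoad_nonneg q A

theorem le_optimalLoad_div (q : unitInterval) (hq : 0 < q) (hT : 0 < T) (hr : 1 ≤ r)
    (hrK : 2 * r < K) (hn : 0 < n₁ + n₂) (hdvd : K ∣ n₁ + n₂) :
    1 / (8 * r) * (1 - 2 * r / K) - |(n₁ : ℝ) - n₂| / ((n₁ + n₂ : ℕ) : ℝ) ≤
      optimalLoad n₁ n₂ K r T q / q := by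
  have : Nonempty (Allocation (Fin n₁ ⊕ Fin n₂) K r) :=
    nonempty_allocation hr (by omega) (by simpa using hdvd)
  rw [le_div_iff₀ (show (0 : ℝ) < q from hq), mul_comm]
  exact le_ciInf fun A => le_integral_commLoad q hT hr hrK hn A

/-- The fluctuation and rounding errors are written through `1 / n ^ 2 / q`, the ratio that tends to
zero when `q = ω(1 / n ^ 2)`. -/
theorem optimalLoad_div_le {h : ℕ} (q : unitInterval) (hq : 0 < q) (hT : 0 < T) (hr : 1 ≤ r)
    (hrh : r ≤ h) (hK : K = 2 * h) (hn : 0 < n₁ + n₂) (hdvd : K ∣ n₁ + n₂) :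
    optimalLoad n₁ n₂ K r T q / q ≤
      1 / (2 * r) * (1 - 2 * r / K) + |(n₁ : ℝ) - n₂| / ((n₁ + n₂ : ℕ) : ℝ) +
        K * h.choose r / ((n₁ + n₂ : ℕ) : ℝ) +
      (r + 1) * (2 * h.choose (r + 1)) * (3 * (r + 1) + 1) *
        (√(1 / ((n₁ + n₂ : ℕ) : ℝ) ^ 2 / q) + 1 / ((n₁ + n₂ : ℕ) : ℝ) ^ 2 / q) := by
  obtain ⟨s, hs⟩ := hdvd
  have hs0 : 0 < s := by
    rcases Nat.eq_zero_or_pos s with rfl | h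
    · omega
    · exact h
  obtain ⟨A, hA⟩ := exists_integral_commLoad_le q hq hT hr hrh hK hs0 hs
  have hq' : (0 : ℝ) < q := hq
  have hle : optimalLoad n₁ n₂ K r T q ≤ _ := (ciInf_le ⟨0, by
    rintro _ ⟨A, rfl⟩
    exact integral_commLoad_nonneg q A⟩ A).trans hA
  have hn' : (0 : ℝ) < ((n₁ + n₂ : ℕ) : ℝ) := by exact_mod_cast hn
  rw [div_le_iff₀ hq']
  refine hle.trans (le_of_eq ?_)
  have e : √(1 / ((n₁ + n₂ : ℕ) : ℝ) ^ 2 / q) * q = √q / ((n₁ + n₂ : ℕ) : ℝ) := by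
    rw [Real.sqrt_div (by positivity), Real.sqrt_div (by positivity), Real.sqrt_one,
      Real.sqrt_sq hn'.le]
    have h1 : √(q : ℝ) ≠ 0 := (Real.sqrt_pos.2 hq').ne'
    have h2 : (q : ℝ) = √q * √q := (Real.mul_self_sqrt hq'.le).symm
    field_simp
    rw [sq, ← h2]
  rw [← e]
  field_simp

end OptimalLoad

/-- Both parts compare the sequence with one whose limit is the claimed constant. In `EReal` the
upper limit is monotone without boundedness conditions. -/
theorem theorem2 (K r : ℕ) (hr : 1 ≤ r) (hrK : r ≤ K)
    (n₁ n₂ T : ℕ → ℕ) (q : ℕ → unitInterval)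
    (hT : ∀ m, 0 < T m) (hq : ∀ m, 0 < q m)
    (hn : Tendsto (fun m => n₁ m + n₂ m) atTop atTop)
    (hdvd : ∀ m, K ∣ n₁ m + n₂ m)
    (hn₁ : (fun m => (n₁ m : ℝ)) =Θ[atTop] fun m => ((n₁ m + n₂ m : ℕ) : ℝ))
    (hn₂ : (fun m => (n₂ m : ℝ)) =Θ[atTop] fun m => ((n₁ m + n₂ m : ℕ) : ℝ))
    (hdiff : (fun m => |(n₁ m : ℝ) - n₂ m|) =o[atTop] fun m => ((n₁ m + n₂ m : ℕ) : ℝ))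
    (hqω : (fun m => 1 / ((n₁ m + n₂ m : ℕ) : ℝ) ^ 2) =o[atTop] fun m => (q m : ℝ)) :
    ((1 / (8 * r) * (1 - 2 * r / K) : ℝ) : EReal) ≤
        limsup (fun m => ((optimalLoad (n₁ m) (n₂ m) K r (T m) (q m) / q m : ℝ) : EReal)) atTop ∧
      (Even K → 2 * r ≤ K →
        limsup (fun m => ((optimalLoad (n₁ m) (n₂ m) K r (T m) (q m) / q m : ℝ) : EReal)) atTop ≤
          ((1 / (2 * r) * (1 - 2 * r / K) : ℝ) : EReal)) := by
  have hpos : ∀ᶠ m in atTop, 0 < n₁ m + n₂ m := hn.eventually_gt_atTop 0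
  have hD := hdiff.tendsto_div_nhds_zero
  have hn' : Tendsto (fun m => ((n₁ m + n₂ m : ℕ) : ℝ)) atTop atTop :=
    tendsto_natCast_atTop_atTop.comp hn
  constructor
  · rcases lt_or_ge (2 * r) K with h | h
    · have hlim : Tendsto (fun m => (((1 / (8 * r) * (1 - 2 * r / K) -
          |(n₁ m : ℝ) - n₂ m| / ((n₁ m + n₂ m : ℕ) : ℝ) : ℝ)) : EReal)) atTop
          (nhds ((1 / (8 * r) * (1 - 2 * r / K) : ℝ) : EReal)) := by
        refine (continuous_coe_real_ereal.tendsto _).comp ?_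
        simpa using (tendsto_const_nhds (x := (1 / (8 * r) * (1 - 2 * r / K) : ℝ))).sub hD
      rw [← hlim.limsup_eq]
      refine limsup_le_limsup ?_
      filter_upwards [hpos] with m hm
      exact EReal.coe_le_coe_iff.2 (le_optimalLoad_div (q m) (hq m) (hT m) hr h hm (hdvd m))
    -- For `K ≤ 2 * r` the constant is not positive, and nonnegativity of the load suffices.
    · have h0 : ((1 / (8 * r) * (1 - 2 * r / K) : ℝ) : EReal) ≤ ((0 : ℝ) : EReal) := by
        rw [EReal.coe_le_coe_iff]
        refine mul_nonpos_of_nonneg_of_nonpos (by positivity) ?_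
        have hK : (0 : ℝ) < K := by exact_mod_cast (show 0 < K by omega)
        rw [sub_nonpos, one_le_div hK]
        exact_mod_cast h
      refine h0.trans ?_
      rw [← (tendsto_const_nhds (x := ((0 : ℝ) : EReal)) (f := (atTop : Filter ℕ))).limsup_eq]
      refine limsup_le_limsup (Eventually.of_forall fun m => ?_)
      exact EReal.coe_le_coe_iff.2
        (div_nonneg (optimalLoad_nonneg _) (show (0 : ℝ) < q m from hq m).le)
  · rintro ⟨h, hK⟩ hrK2
    have hω := hqω.tendsto_div_nhds_zero
    have hsqrt : Tendsto (fun m => √(1 / ((n₁ m + n₂ m : ℕ) : ℝ) ^ 2 / q m)) atTop (nhds 0) := by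
      rw [← Real.sqrt_zero]
      exact (Real.continuous_sqrt.tendsto 0).comp hω
    have hlim : Tendsto (fun m => ((1 / (2 * r) * (1 - 2 * r / K) +
        |(n₁ m : ℝ) - n₂ m| / ((n₁ m + n₂ m : ℕ) : ℝ) +
        K * h.choose r / ((n₁ m + n₂ m : ℕ) : ℝ) +
        (r + 1) * (2 * h.choose (r + 1)) * (3 * (r + 1) + 1) *
          (√(1 / ((n₁ m + n₂ m : ℕ) : ℝ) ^ 2 / q m) +
            1 / ((n₁ m + n₂ m : ℕ) : ℝ) ^ 2 / q m) : ℝ) : EReal)) atTop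
        (nhds ((1 / (2 * r) * (1 - 2 * r / K) : ℝ) : EReal)) := by
      refine (continuous_coe_real_ereal.tendsto _).comp ?_
      have h1 : Tendsto (fun m => (K * h.choose r : ℝ) / ((n₁ m + n₂ m : ℕ) : ℝ)) atTop
          (nhds 0) := hn'.const_div_atTop _
      simpa using (((tendsto_const_nhds (x := (1 / (2 * r) * (1 - 2 * r / K) : ℝ))).add hD).add
        h1).add ((hsqrt.add hω).const_mul
          ((r + 1) * (2 * h.choose (r + 1)) * (3 * (r + 1) + 1) : ℝ))
    rw [← hlim.limsup_eq]
    refine limsup_le_limsup ?_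
    filter_upwards [hpos] with m hm
    exact EReal.coe_le_coe_iff.2 (optimalLoad_div_le (q m) (hq m) (hT m) hr (by omega) (by omega)
      hm (hdvd m))
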